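/- Let $\Gamma$ be a metric graph, i.e. a metric space obtained from a finite connected graph $G$ (loops and multiple edges allowed) and a length function $l:E(G)\to\mathbb{R}_{>0}$ by gluing the intervals $[0,l(e)]$ along their endpoints as prescribed by $G$, with the shortest-path distance; such a pair $(G,l)$ is called a model of $\Gamma$. Assume that $\Gamma$ is not homeomorphic to a circle. Assume that $\Gamma$ is 2-edge-connected, i.e. the graph of its canonical model (whose vertices are the points of valence $\neq 2$) remains connected after the removal of any one edge. Assume also that $\Gamma$ is hyperelliptic, i.e. it has a divisor of degree $2$ and rank $1$. Then there is a unique isometry $i:\Gamma\to\Gamma$ with $i^2=\mathrm{id}$ such that the quotient space $\Gamma/i$ is a tree (i.e. a connected topological graph containing no simple closed curve). Here a divisor on $\Gamma$ is a finite formal $\mathbb{Z}$-linear combination $D=\sum_x D(x)\,x$ of points of $\Gamma$; its degree is $\sum_x D(x)$, and it is effective, written $D\ge 0$, if all $D(x)\ge 0$. A rational function on $\Gamma$ is a continuous piecewise linear function $f:\Gamma\to\mathbb{R}$ with integer slopes, and $\operatorname{div} f$ is the divisor whose coefficient at $x$ is the sum of the outgoing slopes of $f$ at $x$. Two divisors are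 linearly equivalent, written $D\sim D'$, if $D-D'=\operatorname{div} f$ for some rational function $f$. The rank of $D$ is the largest integer $k$ such that for every divisor $E\ge 0$ of degree $k$ there is a divisor $E'\ge 0$ with $D-E\sim E'$. -/

import Mathlib

namespace MetricGraph

/-- The data of a model `(G, l)` of `Γ`, apart from the metric of `Γ`: a finite multigraph (loops and multiple edges allowed)
with vertex set `verts ⊆ Γ` and edge set `Edge`, a length function `len > 0`, and an identification
of `Γ` with the set glued from the intervals `[0, len e]`.  The map `param e`, of which only the
restriction to `[0, len e]` is relevant, is the parametrization of the edge `e`.  The fields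
`zero_mem` to `cover` say that as a set `Γ` is the disjoint union of the vertices and of the
open edges. -/
structure PreModel (Γ : Type*) where
  verts : Set Γ
  verts_finite : verts.Finite
  verts_nonempty : verts.Nonempty
  Edge : Type
  [fintypeEdge : Fintype Edge]
  len : Edge → ℝ
  len_pos : ∀ e, 0 < len e
  param : Edge → ℝ → Γ
  zero_mem : ∀ e, param e 0 ∈ verts
  len_mem : ∀ e, param e (len e) ∈ verts
  interior_notMem : ∀ e, ∀ t ∈ Set.Ioo 0 (len e), param e t ∉ verts
  interior_inj : ∀ e e', ∀ s ∈ Set.Ioo 0 (len e), ∀ t ∈ Set.Ioo 0 (len e'),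
    param e s = param e' t → e = e' ∧ s = t
  cover : ∀ x, x ∈ verts ∨ ∃ e, ∃ t ∈ Set.Ioo 0 (len e), param e t = x

attribute [instance] PreModel.fintypeEdge

/-- `M.PathOfLength x y L`: there is a path of length `L` from `x` to `y`, i.e. a finite
concatenation of segments each of which runs inside one closed edge. -/
inductive PreModel.PathOfLength {Γ : Type*} (M : PreModel Γ) : Γ → Γ → ℝ → Prop
  | refl (x : Γ) : PreModel.PathOfLength M x x 0
  | step (e : M.Edge) (s t : ℝ) (hs : s ∈ Set.Icc 0 (M.len e)) (ht : t ∈ Set.Icc 0 (M.len e))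
      (y : Γ) (L : ℝ) (h : PreModel.PathOfLength M (M.param e t) y L) :
      PreModel.PathOfLength M (M.param e s) y (|s - t| + L)

/-- A model of the metric space `Γ`: the distance in `Γ` is the length of a shortest path.
In particular any two points are joined by a path, so the graph is connected. -/
structure Model (Γ : Type*) [MetricSpace Γ] extends PreModel Γ where
  dist_isLeast : ∀ x y : Γ, IsLeast {L : ℝ | toPreModel.PathOfLength x y L} (dist x y)

/-- A metric graph is a metric space that has a model. -/
def IsMetricGraph (Γ : Type*) [MetricSpace Γ] : Prop := Nonempty (Model Γ)

section

variable {Γ : Type*} [MetricSpace Γ]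

/-- The first endpoint of an edge. -/
def Model.src (M : Model Γ) (e : M.Edge) : Γ := M.param e 0

/-- The second endpoint of an edge (equal to the first one if the edge is a loop). -/
def Model.tgt (M : Model Γ) (e : M.Edge) : Γ := M.param e (M.len e)

/-- The valence of a vertex: the number of edge ends at it (a loop has two ends).
All points of `Γ` that are not vertices have valence `2`. -/
noncomputable def Model.valence (M : Model Γ) (v : Γ) : ℕ :=
  {e : M.Edge | M.src e = v}.ncard + {e : M.Edge | M.tgt e = v}.ncard

/-- The canonical model: the vertices are exactly the points of valence different from `2`. -/
def Model.IsCanonical (M : Model Γ) : Prop := ∀ v ∈ M.verts, M.valence v ≠ 2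

/-- Two points are the two ends of an edge outside `F`. -/
def Model.AdjAvoiding (M : Model Γ) (F : Set M.Edge) (u v : Γ) : Prop :=
  ∃ e, e ∉ F ∧ ((M.src e = u ∧ M.tgt e = v) ∨ (M.src e = v ∧ M.tgt e = u))

/-- The graph underlying the model is `k`-edge-connected: removing any set of at most `k - 1` edges
yields a connected graph. -/
def Model.IsEdgeConnected (M : Model Γ) (k : ℕ) : Prop :=
  ∀ F : Set M.Edge, F.ncard < k →
    ∀ u ∈ M.verts, ∀ v ∈ M.verts, Relation.ReflTransGen (M.AdjAvoiding F) u v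

variable (Γ) in
/-- A metric graph is `k`-edge-connected if the graph of its canonical model is. -/
def IsEdgeConnected (k : ℕ) : Prop :=
  ∃ M : Model Γ, M.IsCanonical ∧ M.IsEdgeConnected k

/-- The function `f` is linear on every edge of the model, with the integer slope `s e` along the
edge `e` (traversed from `M.src e` to `M.tgt e`). -/
def Model.IsLinear (M : Model Γ) (f : Γ → ℝ) (s : M.Edge → ℤ) : Prop :=
  ∀ e, ∀ t ∈ Set.Icc 0 (M.len e), f (M.param e t) = f (M.src e) + s e * t

/-- The divisor that attaches to each point the sum of the outgoing slopes of a function which is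
linear of slope `s e` on each edge `e`: the edge `e` contributes `s e` at its first end and
`- s e` at its second end. -/
noncomputable def Model.divisor (M : Model Γ) (s : M.Edge → ℤ) : Γ →₀ ℤ :=
  ∑ e, (Finsupp.single (M.src e) (s e) - Finsupp.single (M.tgt e) (s e))

/-- `f` is a rational function on `Γ` (continuous and piecewise linear with integer slopes, i.e.
linear with integer slopes on the edges of some model) and `D = div f`. -/
def IsDivisorOf (f : Γ → ℝ) (D : Γ →₀ ℤ) : Prop :=
  Continuous f ∧ ∃ (M : Model Γ) (s : M.Edge → ℤ), M.IsLinear f s ∧ D = M.divisor s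

/-- Principal divisors. -/
def IsPrincipal (D : Γ →₀ ℤ) : Prop := ∃ f : Γ → ℝ, IsDivisorOf f D

/-- Linear equivalence of divisors. -/
def LinEquiv (D D' : Γ →₀ ℤ) : Prop := IsPrincipal (D - D')

/-- The degree of a divisor. -/
def deg (D : Γ →₀ ℤ) : ℤ := D.sum fun _ n => n

/-- The divisor `D` has rank `r`: `r` is the largest integer `k` such that for every effective
divisor `E` of degree `k` there is an effective divisor `E'` with `D - E ∼ E'`. -/
def HasRank (D : Γ →₀ ℤ) (r : ℤ) : Prop :=
  IsGreatest {k : ℤ | ∀ E : Γ →₀ ℤ, 0 ≤ E → deg E = k →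
    ∃ E' : Γ →₀ ℤ, 0 ≤ E' ∧ LinEquiv (D - E) E'} r

variable (Γ) in
/-- A metric graph is hyperelliptic if it has a divisor of degree `2` and rank `1`. -/
def IsHyperelliptic : Prop := ∃ D : Γ →₀ ℤ, deg D = 2 ∧ HasRank D 1

/-- An automorphism (isometry onto itself) is an involution if its square is the identity. -/
def IsInvolution (i : Γ ≃ᵢ Γ) : Prop := ∀ x, i (i x) = x

/-- The quotient `Γ / i`, i.e. the space of orbits of the group generated by `i`,
with the quotient topology. -/
abbrev OrbitSpace (i : Γ ≃ᵢ Γ) : Type _ := Quot fun x y : Γ => i x = y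

end

/-- A (topological) graph is a tree if it is connected and has no cycle, i.e. it contains no
simple closed curve.  (This is applied to quotients of metric graphs by involutions, which are
again finite topological graphs.) -/
def IsTree (X : Type*) [TopologicalSpace X] : Prop :=
  ConnectedSpace X ∧ ¬ ∃ c : Circle → X, Continuous c ∧ Function.Injective c

end MetricGraph

/-! Existence rests on a flux argument. For a function that is linear on the edges of a model, the
total absolute slope through a regular level `c` is bounded by the degree of its divisor on the set
`f < c` (`sum_abs_le_cut`). If no point other than a vertex disconnects `Γ`, at least two edges
cross the level, so that degree is at least two (`two_le_cut`). Hence distinct points are never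
linearly equivalent (`eq_of_isPrincipal`), and a divisor `D` of degree 2 and rank 1 determines for
each `x` one point `i x` with `x + i x ~ D`; clearly `i (i x) = x`.

If `div f = x + x' - y - y'`, the same count shows that `f` is minimal at `x, x'`, maximal at `y,
y'`, and has slopes `0` or `±1`. Ascending from `x'` one arrives at `y` or `y'` after a distance at
most `f y - f x ≤ dist x y`. When `y` is near `x` this gives `dist x' y' ≤ dist x y`
(`dist_le_of_isPrincipal`), so `i` is locally and then globally nonexpanding, and being an
involution it is an isometry. Truncating `f` at a regular level shows that the level is a pair `p,
q` with `p + q ~ x + x'` (`exists_level_pair`). With `x' = i x` it is one orbit, so any two distinct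
points of `Γ / i` are separated by a third, which excludes simple closed curves.

For uniqueness, all vertices of the canonical model have valence at least three once there is an
edge, so isometries preserve the vertices and permute the half-edges. If `Γ / i` is a tree, the
image of a half-edge `h` separates it. This yields a cut function `f` that vanishes at the start `v`
of `h`, rises along `h` and `i h`, and is constant elsewhere; `{f > 0}` is the branch at `v` in the
direction of `h`. For another such involution `j` with cut function `g`, bridgelessness shows that
the two branches agree if `f (j v) = 0` and `g (i v) = 0`, and then `i v = j v` (`map_eq_map`). If
`i v ≠ j v`, then for each of three half-edges at `v` either its branch for `i` contains `j v` or
its branch for `j` contains `i v`, against the disjointness of branches. So `i` and `j` agree on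
vertices, and comparing branches once more, on half-edges. -/

namespace MetricGraph

open Set Filter Topology

/-! ### Functions glued from edges; distances near a point. -/

section Glue

variable {Γ : Type*}

/-- Functions on the vertices and on the edges that agree at the ends of the edges can be glued. -/
theorem PreModel.exists_glue (M : PreModel Γ) {X : Type*} (ν : Γ → X) (φ : M.Edge → ℝ → X)
    (h0 : ∀ e, φ e 0 = ν (M.param e 0)) (h1 : ∀ e, φ e (M.len e) = ν (M.param e (M.len e))) :
    ∃ h : Γ → X, (∀ v ∈ M.verts, h v = ν v) ∧
      ∀ e, ∀ t ∈ Icc 0 (M.len e), h (M.param e t) = φ e t := by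
  classical
  have key : ∀ x, ∃ y, (x ∈ M.verts → y = ν x) ∧
      ∀ e, ∀ t ∈ Icc 0 (M.len e), M.param e t = x → y = φ e t := by
    intro x
    by_cases hx : x ∈ M.verts
    · refine ⟨ν x, fun _ => rfl, fun e t ht hxt => ?_⟩
      rcases eq_or_lt_of_le ht.1 with h | h
      · subst h; rw [h0, hxt]
      rcases eq_or_lt_of_le ht.2 with h' | h'
      · subst h'; rw [h1, hxt]
      · exact absurd (hxt ▸ hx) (M.interior_notMem e t ⟨h, h'⟩)
    · obtain ⟨e, t, ht, hxt⟩ := (M.cover x).resolve_left hx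
      refine ⟨φ e t, fun h => absurd h hx, fun e' t' ht' hxt' => ?_⟩
      rcases eq_or_lt_of_le ht'.1 with h | h
      · subst h; exact absurd (hxt' ▸ M.zero_mem e') hx
      rcases eq_or_lt_of_le ht'.2 with h' | h'
      · subst h'; exact absurd (hxt' ▸ M.len_mem e') hx
      · obtain ⟨rfl, rfl⟩ := M.interior_inj e e' t ht t' ⟨h, h'⟩ (hxt.trans hxt'.symm)
        rfl
  choose h hv he using key
  exact ⟨h, fun v hv' => hv v hv', fun e t ht => he _ e t ht rfl⟩

theorem PreModel.PathOfLength.dist_le {M : PreModel Γ} {X : Type*} [PseudoMetricSpace X]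
    {h : Γ → X}
    (H : ∀ e, ∀ s ∈ Icc 0 (M.len e), ∀ t ∈ Icc 0 (M.len e),
      dist (h (M.param e s)) (h (M.param e t)) ≤ |s - t|) {x y : Γ} {L : ℝ}
    (p : M.PathOfLength x y L) : dist (h x) (h y) ≤ L := by
  induction p with
  | refl x => simp
  | step e s t hs ht y L _ ih =>
    exact (dist_triangle _ _ _).trans (add_le_add (H e s hs t ht) ih)

theorem PreModel.exists_param_eq (M : PreModel Γ) (x : Γ) :
    x ∈ M.verts ∨ ∃ e, ∃ t ∈ Icc 0 (M.len e), M.param e t = x :=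
  (M.cover x).imp_right fun ⟨e, t, ht, h⟩ => ⟨e, t, Ioo_subset_Icc_self ht, h⟩

theorem PreModel.mem_Ioo_of_notMem (M : PreModel Γ) {e : M.Edge} {t : ℝ}
    (ht : t ∈ Icc 0 (M.len e)) (h : M.param e t ∉ M.verts) : t ∈ Ioo 0 (M.len e) := by
  refine ⟨lt_of_le_of_ne ht.1 ?_, lt_of_le_of_ne ht.2 ?_⟩
  · rintro rfl; exact h (M.zero_mem e)
  · rintro rfl; exact h (M.len_mem e)

end Glue

variable {Γ : Type*} [MetricSpace Γ]

namespace Model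

/-- A function that does not increase distances on the edges does not increase distances. -/
theorem dist_le_of_edges (M : Model Γ) {X : Type*} [PseudoMetricSpace X] {h : Γ → X}
    (H : ∀ e, ∀ s ∈ Icc 0 (M.len e), ∀ t ∈ Icc 0 (M.len e),
      dist (h (M.param e s)) (h (M.param e t)) ≤ |s - t|) (x y : Γ) :
    dist (h x) (h y) ≤ dist x y :=
  (M.dist_isLeast x y).1.dist_le H

theorem dist_param_le (M : Model Γ) (e : M.Edge) {s t : ℝ} (hs : s ∈ Icc 0 (M.len e))
    (ht : t ∈ Icc 0 (M.len e)) : dist (M.param e s) (M.param e t) ≤ |s - t| := by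
  have := (M.dist_isLeast (M.param e s) (M.param e t)).2
    (PreModel.PathOfLength.step e s t hs ht _ 0 (.refl _))
  simpa using this

theorem continuousOn_param (M : Model Γ) (e : M.Edge) :
    ContinuousOn (M.param e) (Icc 0 (M.len e)) := by
  have : LipschitzOnWith 1 (M.param e) (Icc 0 (M.len e)) :=
    LipschitzOnWith.of_dist_le_mul fun x hx y hy => by
      simpa [Real.dist_eq] using M.dist_param_le e hx hy
  exact this.continuousOn

theorem left_mem (M : Model Γ) (e : M.Edge) : (0 : ℝ) ∈ Icc 0 (M.len e) :=
  ⟨le_rfl, (M.len_pos e).le⟩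

theorem right_mem (M : Model Γ) (e : M.Edge) : M.len e ∈ Icc 0 (M.len e) :=
  ⟨(M.len_pos e).le, le_rfl⟩

theorem src_mem (M : Model Γ) (e : M.Edge) : M.src e ∈ M.verts := M.zero_mem e

theorem tgt_mem (M : Model Γ) (e : M.Edge) : M.tgt e ∈ M.verts := M.len_mem e

/-- A small ball around an interior point of an edge is contained in the edge. -/
theorem exists_param_of_dist_lt (M : Model Γ) (e : M.Edge) {t r : ℝ} (hr : r ≤ t)
    (hr' : r ≤ M.len e - t) {y : Γ} (hy : dist (M.param e t) y < r) :
    ∃ s ∈ Ioo 0 (M.len e), M.param e s = y ∧ |s - t| = dist (M.param e t) y := by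
  classical
  have hr0 : 0 < r := dist_nonneg.trans_lt hy
  have ht : t ∈ Icc 0 (M.len e) := ⟨by linarith, by linarith⟩
  -- A tent of height `r` centred at `t`. It vanishes at the ends of the edge and is 1-Lipschitz, so
  -- it is positive at `y`.
  obtain ⟨h, hv, he⟩ := M.toPreModel.exists_glue (fun _ => (0 : ℝ))
    (fun e' s => if e' = e then max 0 (r - |s - t|) else 0)
    (by
      intro e'; split_ifs
      · apply max_eq_left; rw [zero_sub, abs_neg, abs_of_nonneg ht.1]; linarith
      · rfl)
    (by
      intro e'; split_ifs with h
      · subst h; apply max_eq_left; rw [abs_of_nonneg (by linarith)]; linarith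
      · rfl)
  have hlip := M.dist_le_of_edges (h := h) (by
    intro e' s hs s' hs'
    rw [he e' s hs, he e' s' hs', Real.dist_eq]
    split_ifs
    · refine (abs_max_sub_max_le_max _ _ _ _).trans ?_
      rw [sub_self, abs_zero]
      refine max_le (abs_nonneg _) ?_
      rw [show r - |s - t| - (r - |s' - t|) = |s' - t| - |s - t| by ring]
      refine (abs_abs_sub_abs_le_abs_sub _ _).trans ?_
      rw [abs_sub_comm]; simp
    · simp) (M.param e t) y
  have h1 : h (M.param e t) = r := by
    rw [he e t ht]; simp [hr0.le]
  have h2 : r - dist (M.param e t) y ≤ h y := by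
    rw [Real.dist_eq, h1] at hlip
    linarith [le_abs_self (r - h y)]
  have hyv : y ∉ M.verts := fun hyv => by rw [hv y hyv] at h2; linarith
  obtain ⟨e', s, hs, rfl⟩ := (M.cover y).resolve_left hyv
  rw [he e' s (Ioo_subset_Icc_self hs)] at h2
  by_cases hee : e' = e
  · subst hee
    refine ⟨s, hs, rfl, le_antisymm ?_ ?_⟩
    · rw [if_pos rfl] at h2
      rcases max_choice 0 (r - |s - t|) with h | h <;> rw [h] at h2 <;> linarith
    · rw [abs_sub_comm]
      exact M.dist_param_le _ ht (Ioo_subset_Icc_self hs)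
  · rw [if_neg hee] at h2; linarith

theorem isOpen_param_Ioo (M : Model Γ) (e : M.Edge) : IsOpen (M.param e '' Ioo 0 (M.len e)) := by
  rw [Metric.isOpen_iff]
  rintro _ ⟨t, ht, rfl⟩
  refine ⟨min t (M.len e - t), lt_min ht.1 (by linarith [ht.2]), fun y hy => ?_⟩
  obtain ⟨s, hs, h, -⟩ := M.exists_param_of_dist_lt e (min_le_left _ _) (min_le_right _ _)
    (by rwa [dist_comm])
  exact ⟨s, hs, h⟩

/-- This is local only: along a whole edge the distance may be realized by a shortcut outside the
edge. -/
theorem dist_param_eq (M : Model Γ) (e : M.Edge) {s t r : ℝ} (hr : r ≤ t)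
    (hr' : r ≤ M.len e - t) (h : |s - t| < r) :
    dist (M.param e t) (M.param e s) = |s - t| := by
  have hs := abs_lt.1 h
  have ht : t ∈ Icc 0 (M.len e) := ⟨by linarith, by linarith⟩
  have hs : s ∈ Ioo 0 (M.len e) := ⟨by linarith, by linarith⟩
  have h1 := M.dist_param_le e ht (Ioo_subset_Icc_self hs)
  rw [abs_sub_comm] at h1
  obtain ⟨s', hs', h2, h3⟩ := M.exists_param_of_dist_lt e hr hr' (h1.trans_lt h)
  rw [← h3, (M.interior_inj e e s' hs' s hs h2).2]

/-- Distances near a vertex. -/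
theorem exists_star (M : Model Γ) : ∃ δ > 0, (∀ e, δ ≤ M.len e / 2) ∧
    (∀ e, ∀ t ∈ Icc 0 δ, dist (M.src e) (M.param e t) = t) ∧
    (∀ e, ∀ t ∈ Icc 0 δ, dist (M.tgt e) (M.param e (M.len e - t)) = t) ∧
    ∀ v ∈ M.verts, ∀ z, dist v z < δ → z = v ∨
      ∃ e, (M.src e = v ∨ M.tgt e = v) ∧ ∃ t ∈ Icc 0 (M.len e), M.param e t = z := by
  classical
  obtain ⟨δ, hδ, hδe⟩ : ∃ δ > 0, ∀ e, δ ≤ M.len e / 2 := by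
    rcases isEmpty_or_nonempty M.Edge with hE | hE
    · exact ⟨1, one_pos, fun e => hE.elim e⟩
    · obtain ⟨e, he⟩ := Finite.exists_min (fun e => M.len e / 2)
      exact ⟨_, half_pos (M.len_pos e), he⟩
  -- The distance from `v`, truncated at `δ`. As `δ` is at most half of every edge, the two ends of
  -- a loop at `v` do not interfere.
  have key : ∀ v, ∃ h : Γ → ℝ, (∀ w ∈ M.verts, h w = if w = v then 0 else δ) ∧
      (∀ e, ∀ t ∈ Icc 0 (M.len e), h (M.param e t) =
        min δ (min ((if M.src e = v then 0 else δ) + t)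
          ((if M.tgt e = v then 0 else δ) + (M.len e - t)))) ∧
      ∀ x y, |h x - h y| ≤ dist x y := by
    intro v
    obtain ⟨h, hv, he⟩ := M.toPreModel.exists_glue (fun w => if w = v then 0 else δ)
      (fun e t => min δ (min ((if M.src e = v then 0 else δ) + t)
          ((if M.tgt e = v then 0 else δ) + (M.len e - t))))
      (by
        intro e
        have := hδe e
        change min δ (min ((if M.src e = v then 0 else δ) + 0)
          ((if M.tgt e = v then 0 else δ) + (M.len e - 0))) = if M.src e = v then 0 else δ
        rw [min_eq_left (a := _ + _) (by split_ifs <;> linarith), add_zero]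
        exact min_eq_right (by split_ifs <;> linarith))
      (by
        intro e
        have := hδe e
        change min δ (min ((if M.src e = v then 0 else δ) + M.len e)
          ((if M.tgt e = v then 0 else δ) + (M.len e - M.len e))) = if M.tgt e = v then 0 else δ
        rw [min_eq_right (a := _ + _) (by split_ifs <;> linarith), sub_self, add_zero]
        exact min_eq_right (by split_ifs <;> linarith))
    refine ⟨h, hv, he, fun x y => ?_⟩
    rw [← Real.dist_eq]
    refine M.dist_le_of_edges (fun e s hs t ht => ?_) x y
    rw [he e s hs, he e t ht, Real.dist_eq]
    refine (abs_min_sub_min_le_max _ _ _ _).trans (max_le (by simp) ?_)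
    refine (abs_min_sub_min_le_max _ _ _ _).trans (max_le (by simp) ?_)
    rw [add_sub_add_left_eq_sub, sub_sub_sub_cancel_left, abs_sub_comm]
  refine ⟨δ, hδ, hδe, fun e t ht => ?_, fun e t ht => ?_, fun v hv z hz => ?_⟩
  · have hte : t ∈ Icc 0 (M.len e) := ⟨ht.1, by linarith [ht.2, hδe e, M.len_pos e]⟩
    refine le_antisymm ?_ ?_
    · have := M.dist_param_le e (M.left_mem e) hte
      rwa [zero_sub, abs_neg, abs_of_nonneg ht.1] at this
    · obtain ⟨h, hv, he, hd⟩ := key (M.src e)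
      have h1 := hd (M.src e) (M.param e t)
      rw [hv _ (M.src_mem e), he e t hte, if_pos rfl, abs_sub_comm, sub_zero] at h1
      refine le_trans ?_ ((le_abs_self _).trans h1)
      refine le_min ht.2 (le_min (by simp) ?_)
      have := hδe e
      split_ifs <;> linarith [ht.2, ht.1]
  · have hte : M.len e - t ∈ Icc 0 (M.len e) :=
      ⟨by linarith [ht.2, hδe e, M.len_pos e], by linarith [ht.1]⟩
    refine le_antisymm ?_ ?_
    · have := M.dist_param_le e (M.right_mem e) hte
      rwa [sub_sub_cancel, abs_of_nonneg ht.1] at this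
    · obtain ⟨h, hv, he, hd⟩ := key (M.tgt e)
      have h1 := hd (M.tgt e) (M.param e (M.len e - t))
      rw [hv _ (M.tgt_mem e), he e _ hte, if_pos rfl, abs_sub_comm, sub_zero,
        sub_sub_cancel] at h1
      refine le_trans ?_ ((le_abs_self _).trans h1)
      refine le_min ht.2 (le_min ?_ (by simp))
      have := hδe e
      split_ifs <;> linarith [ht.2, ht.1]
  · obtain ⟨h, hv', he, hd⟩ := key v
    have h1 := hd v z
    rw [hv' v hv, if_pos rfl, zero_sub, abs_neg] at h1
    have h2 : h z < δ := (le_abs_self _).trans_lt (h1.trans_lt hz)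
    rcases M.toPreModel.exists_param_eq z with hz' | ⟨e, t, ht, rfl⟩
    · left
      by_contra hne
      rw [hv' z hz', if_neg hne] at h2
      exact lt_irrefl _ h2
    · right
      refine ⟨e, ?_, t, ht, rfl⟩
      by_contra hne
      rw [not_or] at hne
      rw [he e t ht, if_neg hne.1, if_neg hne.2] at h2
      refine absurd h2 (not_lt.2 (le_min le_rfl (le_min ?_ ?_))) <;> linarith [ht.1, ht.2]

end Model

end MetricGraph

/-! ### Models with the same vertices; subdivision and common refinements. -/

namespace MetricGraph

open Set Filter Topology

/-- The derivative of `θ s - s` is zero, so `θ` is a translation, and a translation of `(0, a)` onto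
`(0, b)` is trivial. -/
theorem eq_id_of_strictMonoOn {a b : ℝ} (ha : 0 < a) {θ : ℝ → ℝ}
    (hm : MapsTo θ (Ioo 0 a) (Ioo 0 b)) (hs : SurjOn θ (Ioo 0 a) (Ioo 0 b))
    (hmono : StrictMonoOn θ (Ioo 0 a))
    (hloc : ∀ t ∈ Ioo 0 a, ∀ᶠ s in 𝓝 t, |θ s - θ t| = |s - t|) :
    a = b ∧ ∀ t ∈ Ioo 0 a, θ t = t := by
  have hd : ∀ t ∈ Ioo 0 a, HasDerivAt (fun s => θ s - s) 0 t := by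
    intro t ht
    refine (hasDerivAt_const t (θ t - t)).congr_of_eventuallyEq ?_
    filter_upwards [hloc t ht, isOpen_Ioo.mem_nhds ht] with s h1 hs'
    rcases lt_trichotomy s t with h | h | h
    · have := hmono hs' ht h
      rw [abs_of_neg (by linarith), abs_of_neg (by linarith)] at h1
      linarith
    · rw [h]
    · have := hmono ht hs' h
      rw [abs_of_pos (by linarith), abs_of_pos (by linarith)] at h1
      linarith
  obtain ⟨c, hc⟩ := isOpen_Ioo.exists_is_const_of_deriv_eq_zero isPreconnected_Ioo
    (fun t ht => (hd t ht).differentiableAt.differentiableWithinAt)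
    (fun t ht => (hd t ht).deriv)
  have hc' : ∀ t ∈ Ioo 0 a, θ t = t + c := fun t ht => by have := hc t ht; linarith
  have hb : 0 < b := by
    have := hm (show a / 2 ∈ Ioo 0 a from ⟨by linarith, by linarith⟩)
    exact this.1.trans this.2
  have hc0 : c = 0 := by
    refine le_antisymm ?_ ?_
    · by_contra h
      push Not at h
      obtain ⟨t, ht, htu⟩ := hs (show min c (b / 2) ∈ Ioo 0 b from
        ⟨lt_min h (by linarith), (min_le_right _ _).trans_lt (by linarith)⟩)
      rw [hc' t ht] at htu
      have := min_le_left c (b / 2)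
      linarith [ht.1]
    · by_contra h
      push Not at h
      have ht : min (-c) (a / 2) ∈ Ioo 0 a :=
        ⟨lt_min (by linarith) (by linarith), (min_le_right _ _).trans_lt (by linarith)⟩
      have := (hm ht).1
      rw [hc' _ ht] at this
      linarith [min_le_left (-c) (a / 2)]
  subst hc0
  refine ⟨le_antisymm ?_ ?_, fun t ht => by rw [hc' t ht, add_zero]⟩
  · by_contra h
    push Not at h
    have := (hm (show b ∈ Ioo 0 a from ⟨hb, h⟩)).2
    rw [hc' b ⟨hb, h⟩] at this
    linarith
  · by_contra h
    push Not at h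
    obtain ⟨t, ht, htu⟩ := hs (show a ∈ Ioo 0 b from ⟨ha, h⟩)
    rw [hc' t ht] at htu
    linarith [ht.2]

/-- A locally isometric bijection between open intervals is the identity or a reflection. -/
theorem eq_id_or_reflection {a b : ℝ} (ha : 0 < a) {θ : ℝ → ℝ}
    (hm : MapsTo θ (Ioo 0 a) (Ioo 0 b)) (hs : SurjOn θ (Ioo 0 a) (Ioo 0 b))
    (hi : InjOn θ (Ioo 0 a))
    (hloc : ∀ t ∈ Ioo 0 a, ∀ᶠ s in 𝓝 t, |θ s - θ t| = |s - t|) :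
    a = b ∧ ((∀ t ∈ Ioo 0 a, θ t = t) ∨ ∀ t ∈ Ioo 0 a, θ t = a - t) := by
  have hcont : ContinuousOn θ (Ioo 0 a) := by
    intro t ht
    refine ContinuousAt.continuousWithinAt ?_
    rw [ContinuousAt, tendsto_iff_dist_tendsto_zero]
    have : Tendsto (fun s : ℝ => |s - t|) (𝓝 t) (𝓝 0) := by
      have : ContinuousAt (fun s : ℝ => |s - t|) t := by fun_prop
      simpa [ContinuousAt] using this
    refine this.congr' ?_
    filter_upwards [hloc t ht] with s h
    rw [Real.dist_eq, h]
  rcases hcont.strictMonoOn_of_injOn_Ioo ha hi with h | h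
  · obtain ⟨h1, h2⟩ := eq_id_of_strictMonoOn ha hm hs h hloc
    exact ⟨h1, Or.inl h2⟩
  · obtain ⟨h1, h2⟩ := eq_id_of_strictMonoOn (θ := fun t => b - θ t) (b := b) ha
      (fun t ht => ⟨by linarith [(hm ht).2], by linarith [(hm ht).1]⟩)
      (fun u hu => by
        obtain ⟨t, ht, htu⟩ := hs (show b - u ∈ Ioo 0 b from
          ⟨by linarith [hu.2], by linarith [hu.1]⟩)
        exact ⟨t, ht, by simp only [htu]; ring⟩)
      (fun s hs t ht hst => sub_lt_sub_left (h hs ht hst) b)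
      (fun t ht => by
        filter_upwards [hloc t ht] with s h
        rw [sub_sub_sub_cancel_left, abs_sub_comm, h])
    exact ⟨h1, Or.inr fun t ht => by linarith [h2 t ht]⟩

variable {Γ : Type*} [MetricSpace Γ]

namespace Model

/-- An open edge of `M` is connected and avoids the common vertices, whose complement is the
disjoint union of the open sets given by the open edges of `M'`. -/
theorem image_Ioo_subset (M M' : Model Γ) (h : M.verts = M'.verts) {e : M.Edge} {e' : M'.Edge}
    {t t' : ℝ} (ht : t ∈ Ioo 0 (M.len e)) (ht' : t' ∈ Ioo 0 (M'.len e'))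
    (heq : M.param e t = M'.param e' t') :
    M.param e '' Ioo 0 (M.len e) ⊆ M'.param e' '' Ioo 0 (M'.len e') := by
  refine IsPreconnected.subset_left_of_subset_union (M'.isOpen_param_Ioo e')
    (v := ⋃ e'' ∈ {e'' | e'' ≠ e'}, M'.param e'' '' Ioo 0 (M'.len e''))
    (isOpen_biUnion fun e'' _ => M'.isOpen_param_Ioo e'') ?_ ?_ ?_ ?_
  · rw [disjoint_left]
    rintro _ ⟨s, hs, rfl⟩ hx
    simp only [mem_iUnion] at hx
    obtain ⟨e'', hne, s', hs', hss⟩ := hx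
    exact hne (M'.interior_inj _ _ _ hs' _ hs hss).1
  · rintro _ ⟨s, hs, rfl⟩
    obtain ⟨e'', s', hs', hss⟩ := (M'.cover (M.param e s)).resolve_left
      (h ▸ M.interior_notMem e s hs)
    by_cases hee : e'' = e'
    · subst hee; exact Or.inl ⟨s', hs', hss⟩
    · exact Or.inr (mem_biUnion (x := e'') hee ⟨s', hs', hss⟩)
  · exact ⟨_, ⟨t, ht, rfl⟩, ⟨t', ht', heq.symm⟩⟩
  · exact isPreconnected_Ioo.image _ ((M.continuousOn_param e).mono Ioo_subset_Icc_self)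

theorem eqOn_Icc_of_eqOn_Ioo {X : Type*} [TopologicalSpace X] [T2Space X] {f g : ℝ → X} {a : ℝ}
    (ha : 0 < a) (hf : ContinuousOn f (Icc 0 a)) (hg : ContinuousOn g (Icc 0 a))
    (h : EqOn f g (Ioo 0 a)) : EqOn f g (Icc 0 a) :=
  h.of_subset_closure hf hg Ioo_subset_Icc_self (by rw [closure_Ioo ha.ne])

/-- Two models with the same vertices have the same edges up to orientation. -/
theorem exists_edge_eq (M M' : Model Γ) (h : M.verts = M'.verts) (e : M.Edge) :
    ∃ e' : M'.Edge, M.len e = M'.len e' ∧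
      ((∀ t ∈ Icc 0 (M.len e), M.param e t = M'.param e' t) ∨
        ∀ t ∈ Icc 0 (M.len e), M.param e t = M'.param e' (M.len e - t)) := by
  have hlen := M.len_pos e
  have hmid : M.len e / 2 ∈ Ioo 0 (M.len e) := ⟨by linarith, by linarith⟩
  obtain ⟨e', t', ht', heq⟩ := (M'.cover (M.param e (M.len e / 2))).resolve_left
    (h ▸ M.interior_notMem e _ hmid)
  have hsub := image_Ioo_subset M M' h hmid ht' heq.symm
  have hsub' := image_Ioo_subset M' M h.symm ht' hmid heq
  have : ∀ t, ∃ t', t ∈ Ioo 0 (M.len e) → t' ∈ Ioo 0 (M'.len e') ∧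
      M.param e t = M'.param e' t' := by
    intro t
    by_cases ht : t ∈ Ioo 0 (M.len e)
    · obtain ⟨t', h1, h2⟩ := hsub ⟨t, ht, rfl⟩
      exact ⟨t', fun _ => ⟨h1, h2.symm⟩⟩
    · exact ⟨0, fun h => absurd h ht⟩
  -- The change of parameter is locally isometric because both parametrizations are so near interior
  -- points.
  choose θ hθ using this
  obtain ⟨hl, hor⟩ := eq_id_or_reflection (θ := θ) (M.len_pos e) (b := M'.len e')
    (fun t ht => (hθ t ht).1)
    (fun u hu => by
      obtain ⟨t, ht, htu⟩ := hsub' ⟨u, hu, rfl⟩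
      exact ⟨t, ht, (M'.interior_inj _ _ _ (hθ t ht).1 _ hu ((hθ t ht).2.symm.trans htu)).2⟩)
    (fun s hs t ht hst => by
      refine (M.interior_inj e e s hs t ht ?_).2
      rw [(hθ s hs).2, (hθ t ht).2, hst])
    (by
      intro t ht
      have h1 := (hθ t ht).1
      set r := min (min t (M.len e - t)) (min (θ t) (M'.len e' - θ t)) with hr
      have hr0 : 0 < r := lt_min (lt_min ht.1 (by linarith [ht.2]))
        (lt_min h1.1 (by linarith [h1.2]))
      filter_upwards [Metric.ball_mem_nhds t hr0, isOpen_Ioo.mem_nhds ht] with s hs hs'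
      have hd := M.dist_param_eq e ((min_le_left _ _).trans (min_le_left _ _) : r ≤ t)
        ((min_le_left _ _).trans (min_le_right _ _)) hs
      have h2 := (hθ s hs').1
      rw [(hθ t ht).2, (hθ s hs').2] at hd
      obtain ⟨s', hs'', h3, h4⟩ := M'.exists_param_of_dist_lt e'
        ((min_le_right _ _).trans (min_le_left _ _) : r ≤ θ t)
        ((min_le_right _ _).trans (min_le_right _ _)) (y := M'.param e' (θ s)) (by rw [hd]; exact hs)
      rw [← (M'.interior_inj _ _ _ hs'' _ h2 h3).2, h4, hd])
  refine ⟨e', hl, hor.imp (fun hid => ?_) fun href => ?_⟩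
  · refine eqOn_Icc_of_eqOn_Ioo (M.len_pos e) (M.continuousOn_param e)
      (hl ▸ M'.continuousOn_param e') fun t ht => ?_
    rw [(hθ t ht).2, hid t ht]
  · refine eqOn_Icc_of_eqOn_Ioo (M.len_pos e) (M.continuousOn_param e)
      ((M'.continuousOn_param e').comp (by fun_prop) fun t ht => ?_) fun t ht => ?_
    · rw [← hl]; exact ⟨by linarith [ht.2], by linarith [ht.1]⟩
    · simp only [(hθ t ht).2, href t ht]

/-- The function `f` is linear with integer slopes on the edges of `M`, and its divisor is `D`. -/
def Linearizes (M : Model Γ) (f : Γ → ℝ) (D : Γ →₀ ℤ) : Prop :=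
  ∃ s, M.IsLinear f s ∧ D = M.divisor s

/-- Reversing an edge negates the slope and swaps the ends, so its contribution to the divisor is
unchanged. -/
theorem Linearizes.of_verts_eq {M M' : Model Γ} (h : M.verts = M'.verts) {f : Γ → ℝ}
    {D : Γ →₀ ℤ} (hf : M'.Linearizes f D) : M.Linearizes f D := by
  obtain ⟨s', hs', rfl⟩ := hf
  choose σ hσl hσ using M.exists_edge_eq M' h
  have key : ∀ e, ∃ n : ℤ, (∀ t ∈ Icc 0 (M.len e), f (M.param e t) = f (M.src e) + n * t) ∧
      Finsupp.single (M'.src (σ e)) (s' (σ e)) - Finsupp.single (M'.tgt (σ e)) (s' (σ e)) =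
        Finsupp.single (M.src e) n - Finsupp.single (M.tgt e) n := by
    intro e
    rcases hσ e with h1 | h1
    · refine ⟨s' (σ e), fun t ht => ?_, ?_⟩
      · rw [h1 t ht, hs' _ t (hσl e ▸ ht), Model.src, Model.src, h1 0 (M.left_mem e)]
      · simp only [Model.src, Model.tgt, h1 _ (M.left_mem e), h1 _ (M.right_mem e), ← hσl e]
    · refine ⟨- s' (σ e), fun t ht => ?_, ?_⟩
      · have h2 : M.len e - t ∈ Icc 0 (M'.len (σ e)) := by
          rw [← hσl]; exact ⟨by linarith [ht.2], by linarith [ht.1]⟩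
        rw [h1 t ht, hs' _ _ h2, Model.src, Model.src, h1 0 (M.left_mem e), sub_zero, hσl e,
          hs' _ _ (M'.right_mem _), Model.src]
        push_cast
        ring
      · have h2 : M.src e = M'.tgt (σ e) := by
          rw [Model.src, h1 _ (M.left_mem e), sub_zero, hσl e, Model.tgt]
        have h3 : M.tgt e = M'.src (σ e) := by
          rw [Model.tgt, h1 _ (M.right_mem e), sub_self, Model.src]
        rw [h2, h3, Finsupp.single_neg, Finsupp.single_neg]
        abel
  choose s hs hdiv using key
  refine ⟨s, hs, ?_⟩
  have hbij : Function.Bijective σ := by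
    refine ⟨fun e₁ e₂ h12 => ?_, fun e' => ?_⟩
    · have hlen := M.len_pos e₁
      have hm : M.len e₁ / 2 ∈ Ioo 0 (M.len e₁) := ⟨by linarith, by linarith⟩
      have hl : M.len e₂ = M.len e₁ := by rw [hσl, hσl, h12]
      -- The midpoint does not depend on the orientation.
      have half : ∀ e, M.param e (M.len e / 2) = M'.param (σ e) (M.len e / 2) := by
        intro e
        have := M.len_pos e
        have hm' : M.len e / 2 ∈ Icc 0 (M.len e) := ⟨by linarith, by linarith⟩
        rcases hσ e with h1 | h1
        · exact h1 _ hm'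
        · rw [h1 _ hm']; congr 1; ring
      refine (M.interior_inj e₁ e₂ _ hm _ (hl.symm ▸ hm) ?_).1
      rw [half, ← hl, half, h12]
    · obtain ⟨e, hl, h2⟩ := M'.exists_edge_eq M h.symm e'
      refine ⟨e, ?_⟩
      have hlen := M.len_pos e
      have hm : M.len e / 2 ∈ Icc 0 (M.len e) := ⟨by linarith, by linarith⟩
      have hm' : M.len e / 2 ∈ Ioo 0 (M.len e) := ⟨by linarith, by linarith⟩
      have e1 : M'.param e' (M.len e / 2) = M.param e (M.len e / 2) := by
        rcases h2 with h2 | h2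
        · exact h2 _ (hl ▸ hm)
        · rw [h2 _ (hl ▸ hm), hl]; congr 1; ring
      have e2 : M.param e (M.len e / 2) = M'.param (σ e) (M.len e / 2) := by
        rcases hσ e with h1 | h1
        · exact h1 _ hm
        · rw [h1 _ hm]; congr 1; ring
      exact (M'.interior_inj _ _ _ (hσl e ▸ hm') _ (hl ▸ hm') (e2.symm.trans e1.symm)).1
  unfold Model.divisor
  exact ((Fintype.sum_bijective σ hbij _ _ fun e => (hdiv e).symm)).symm

open Classical in
/-- The combinatorial data of the subdivision of a model at an interior point of an edge. -/
noncomputable def subdividePre (M : Model Γ) (e₀ : M.Edge) (t₀ : ℝ)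
    (ht₀ : t₀ ∈ Ioo 0 (M.len e₀)) : PreModel Γ where
  verts := insert (M.param e₀ t₀) M.verts
  verts_finite := M.verts_finite.insert _
  verts_nonempty := insert_nonempty _ _
  -- `some e₀` is cut down to `[0, t₀]`; `none` is the rest of `e₀`, with the parameter shifted by
  -- `t₀`.
  Edge := Option M.Edge
  fintypeEdge := inferInstance
  len o := o.elim (M.len e₀ - t₀) fun e => if e = e₀ then t₀ else M.len e
  len_pos := by
    rintro (_ | e)
    · exact sub_pos.2 ht₀.2
    · simp only [Option.elim_some]; split_ifs
      · exact ht₀.1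
      · exact M.len_pos e
  param o t := o.elim (M.param e₀ (t₀ + t)) fun e => M.param e t
  zero_mem := by
    rintro (_ | e)
    · simp
    · exact Or.inr (M.zero_mem e)
  len_mem := by
    rintro (_ | e)
    · simpa using Or.inr (M.len_mem e₀)
    · simp only [Option.elim_some]; split_ifs with h
      · subst h; exact Or.inl rfl
      · exact Or.inr (M.len_mem e)
  interior_notMem := by
    rintro (_ | e) t ht
    · simp only [Option.elim_none] at ht ⊢
      have ht' : t₀ + t ∈ Ioo 0 (M.len e₀) := ⟨by linarith [ht.1, ht₀.1], by linarith [ht.2]⟩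
      rintro (h | h)
      · have := (M.interior_inj _ _ _ ht' _ ht₀ h).2
        linarith [ht.1]
      · exact M.interior_notMem _ _ ht' h
    · simp only [Option.elim_some] at ht ⊢
      have ht' : t ∈ Ioo 0 (M.len e) := by
        split_ifs at ht with h
        · subst h; exact ⟨ht.1, ht.2.trans ht₀.2⟩
        · exact ht
      rintro (h | h)
      · obtain ⟨rfl, rfl⟩ := M.interior_inj _ _ _ ht' _ ht₀ h
        simp at ht
      · exact M.interior_notMem _ _ ht' h
  interior_inj := by
    have aux : ∀ e t, t ∈ Ioo 0 (if e = e₀ then t₀ else M.len e) → t ∈ Ioo 0 (M.len e) := by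
      intro e t ht
      split_ifs at ht with h
      · subst h; exact ⟨ht.1, ht.2.trans ht₀.2⟩
      · exact ht
    have aux' : ∀ t, t ∈ Ioo 0 (M.len e₀ - t₀) → t₀ + t ∈ Ioo 0 (M.len e₀) := by
      intro t ht
      exact ⟨by linarith [ht.1, ht₀.1], by linarith [ht.2]⟩
    rintro (_ | e) (_ | e') s hs t ht h <;>
      simp only [Option.elim_some, Option.elim_none] at hs ht h
    · have := (M.interior_inj _ _ _ (aux' s hs) _ (aux' t ht) h).2
      exact ⟨rfl, by linarith⟩
    · obtain ⟨rfl, rfl⟩ := M.interior_inj _ _ _ (aux' s hs) _ (aux _ t ht) h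
      rw [if_pos rfl] at ht
      linarith [hs.1, ht.2]
    · obtain ⟨rfl, rfl⟩ := M.interior_inj _ _ _ (aux _ s hs) _ (aux' t ht) h
      rw [if_pos rfl] at hs
      linarith [hs.2, ht.1]
    · obtain ⟨rfl, rfl⟩ := M.interior_inj _ _ _ (aux _ s hs) _ (aux _ t ht) h
      exact ⟨rfl, rfl⟩
  cover := by
    intro x
    rcases M.cover x with h | ⟨e, t, ht, rfl⟩
    · exact Or.inl (Or.inr h)
    by_cases he : e = e₀
    · subst he
      rcases lt_trichotomy t t₀ with h | h | h
      · exact Or.inr ⟨some e, t, by simpa using ⟨ht.1, h⟩, rfl⟩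
      · subst h; exact Or.inl (Or.inl rfl)
      · refine Or.inr ⟨none, t - t₀, ?_, ?_⟩
        · exact ⟨by linarith, by simpa using ht.2⟩
        · simp
    · exact Or.inr ⟨some e, t, by simpa [he] using ht, rfl⟩

/-- A segment of `e₀` that passes `t₀` splits there into two whose lengths add up, so subdivision
does not change the metric. -/
theorem subdividePre_pathOfLength_iff (M : Model Γ) (e₀ : M.Edge) (t₀ : ℝ)
    (ht₀ : t₀ ∈ Ioo 0 (M.len e₀)) (x y : Γ) (L : ℝ) :
    (M.subdividePre e₀ t₀ ht₀).PathOfLength x y L ↔ M.PathOfLength x y L := by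
  classical
  constructor
  · intro h
    induction h with
    | refl x => exact .refl x
    | step o s t hs ht y L _ ih =>
      rcases o with _ | e
      · have h1 : ∀ u ∈ Icc 0 (M.len e₀ - t₀), t₀ + u ∈ Icc 0 (M.len e₀) := fun u hu =>
          ⟨by linarith [hu.1, ht₀.1], by linarith [hu.2]⟩
        have := PreModel.PathOfLength.step e₀ (t₀ + s) (t₀ + t) (h1 s hs) (h1 t ht) y L ih
        rwa [add_sub_add_left_eq_sub] at this
      · have h1 : ∀ u ∈ Icc 0 (if e = e₀ then t₀ else M.len e), u ∈ Icc 0 (M.len e) := by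
          intro u hu
          split_ifs at hu with h
          · subst h; exact ⟨hu.1, hu.2.trans ht₀.2.le⟩
          · exact hu
        exact PreModel.PathOfLength.step e s t (h1 s hs) (h1 t ht) y L ih
  · intro h
    induction h with
    | refl x => exact .refl x
    | step e s t hs ht y L _ ih =>
      by_cases he : e = e₀
      · subst he
        have left : ∀ s t y L, s ∈ Icc 0 t₀ → t ∈ Icc 0 t₀ →
            (M.subdividePre e t₀ ht₀).PathOfLength (M.param e t) y L →
            (M.subdividePre e t₀ ht₀).PathOfLength (M.param e s) y (|s - t| + L) := by
          intro s t y L hs ht ih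
          exact PreModel.PathOfLength.step (M := M.subdividePre e t₀ ht₀) (some e) s t
            (by simpa [subdividePre] using hs) (by simpa [subdividePre] using ht) y L ih
        have right : ∀ s t y L, s ∈ Icc t₀ (M.len e) → t ∈ Icc t₀ (M.len e) →
            (M.subdividePre e t₀ ht₀).PathOfLength (M.param e t) y L →
            (M.subdividePre e t₀ ht₀).PathOfLength (M.param e s) y (|s - t| + L) := by
          intro s t y L hs ht ih
          have := PreModel.PathOfLength.step (M := M.subdividePre e t₀ ht₀) none (s - t₀) (t - t₀)
            (by simpa [subdividePre] using hs) (by simpa [subdividePre] using ht) y L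
            (by simpa [subdividePre] using ih)
          simpa [subdividePre] using this
        have hm1 : t₀ ∈ Icc 0 t₀ := ⟨ht₀.1.le, le_rfl⟩
        have hm2 : t₀ ∈ Icc t₀ (M.len e) := ⟨le_rfl, ht₀.2.le⟩
        rcases le_total s t₀ with h1 | h1 <;> rcases le_total t t₀ with h2 | h2
        · exact left _ _ _ _ ⟨hs.1, h1⟩ ⟨ht.1, h2⟩ ih
        · have := left s t₀ _ _ ⟨hs.1, h1⟩ hm1 (right t₀ t _ _ hm2 ⟨h2, ht.2⟩ ih)
          rwa [← add_assoc, abs_of_nonpos (by linarith), abs_of_nonpos (by linarith),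
            show -(s - t₀) + -(t₀ - t) = -(s - t) by ring,
            ← abs_of_nonpos (by linarith : s - t ≤ 0)] at this
        · have := right s t₀ _ _ ⟨h1, hs.2⟩ hm2 (left t₀ t _ _ hm1 ⟨ht.1, h2⟩ ih)
          rwa [← add_assoc, abs_of_nonneg (by linarith), abs_of_nonneg (by linarith),
            show (s - t₀) + (t₀ - t) = s - t by ring,
            ← abs_of_nonneg (by linarith : 0 ≤ s - t)] at this
        · exact right _ _ _ _ ⟨h1, hs.2⟩ ⟨h2, ht.2⟩ ih
      · exact PreModel.PathOfLength.step (M := M.subdividePre e₀ t₀ ht₀) (some e) s t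
            (by simpa [subdividePre, he] using hs) (by simpa [subdividePre, he] using ht) y L ih

/-- The subdivision of a model at an interior point of an edge. -/
noncomputable def subdivide (M : Model Γ) (e₀ : M.Edge) (t₀ : ℝ)
    (ht₀ : t₀ ∈ Ioo 0 (M.len e₀)) : Model Γ where
  toPreModel := M.subdividePre e₀ t₀ ht₀
  dist_isLeast x y := by
    simp only [subdividePre_pathOfLength_iff]
    exact M.dist_isLeast x y

/-- The new vertex ends one part of `e₀` and starts the other, with equal slopes, so its coefficient
is zero. -/
theorem Linearizes.subdivide {M : Model Γ} {f : Γ → ℝ} {D : Γ →₀ ℤ} (h : M.Linearizes f D)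
    (e₀ : M.Edge) (t₀ : ℝ) (ht₀ : t₀ ∈ Ioo 0 (M.len e₀)) :
    (M.subdivide e₀ t₀ ht₀).Linearizes f D := by
  classical
  obtain ⟨s, hs, rfl⟩ := h
  refine ⟨fun o => o.elim (s e₀) s, ?_, ?_⟩
  · rintro (_ | e) t ht
    · have ht : t ∈ Icc 0 (M.len e₀ - t₀) := ht
      have h1 : f (M.param e₀ (t₀ + t)) = _ :=
        hs e₀ (t₀ + t) ⟨by linarith [ht.1, ht₀.1], by linarith [ht.2]⟩
      have h2 : f (M.param e₀ (t₀ + 0)) = _ :=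
        hs e₀ (t₀ + 0) ⟨by linarith [ht₀.1], by linarith [ht₀.2]⟩
      change f (M.param e₀ (t₀ + t)) = f (M.param e₀ (t₀ + 0)) + (s e₀ : ℝ) * t
      rw [h1, h2]; ring
    · refine hs e t ?_
      replace ht : t ∈ Icc 0 (if e = e₀ then t₀ else M.len e) := ht
      split_ifs at ht with h
      · subst h; exact ⟨ht.1, ht.2.trans ht₀.2.le⟩
      · exact ht
  · have key : ∀ e, (Finsupp.single (M.src e) (s e) -
        Finsupp.single (M.param e (if e = e₀ then t₀ else M.len e)) (s e) : Γ →₀ ℤ) =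
        (Finsupp.single (M.src e) (s e) - Finsupp.single (M.tgt e) (s e)) +
          if e = e₀ then (Finsupp.single (M.tgt e₀) (s e₀) -
            Finsupp.single (M.param e₀ t₀) (s e₀)) else 0 := by
      intro e
      split_ifs with h
      · subst h; abel
      · rw [add_zero]; rfl
    have : (M.subdivide e₀ t₀ ht₀).divisor (fun o => o.elim (s e₀) s) =
        (Finsupp.single (M.param e₀ (t₀ + 0)) (s e₀) -
          Finsupp.single (M.param e₀ (t₀ + (M.len e₀ - t₀))) (s e₀)) +
        ∑ e, (Finsupp.single (M.src e) (s e) -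
          Finsupp.single (M.param e (if e = e₀ then t₀ else M.len e)) (s e)) :=
      Fintype.sum_option (α := M.Edge) (fun o => _)
    rw [this, Finset.sum_congr rfl fun e _ => key e, Finset.sum_add_distrib,
      Finset.sum_ite_eq' Finset.univ e₀, if_pos (Finset.mem_univ _), add_zero,
      add_sub_cancel, Model.divisor]
    change _ = (_ - Finsupp.single (M.tgt e₀) (s e₀)) + _
    abel

theorem exists_refinement (M : Model Γ) {S : Set Γ} (hS : S.Finite) :
    ∃ M' : Model Γ, M'.verts = M.verts ∪ S ∧
      ∀ f D, M.Linearizes f D → M'.Linearizes f D := by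
  induction S, hS using Set.Finite.induction_on with
  | empty => exact ⟨M, by simp, fun _ _ h => h⟩
  | @insert p S _ _ ih =>
    obtain ⟨M', hv, hM'⟩ := ih
    by_cases hp : p ∈ M'.verts
    · exact ⟨M', by rw [union_insert, insert_eq_of_mem (hv ▸ hp), hv], hM'⟩
    · obtain ⟨e, t, ht, rfl⟩ := (M'.cover p).resolve_left hp
      refine ⟨M'.subdivide e t ht, ?_, fun f D h => (hM' f D h).subdivide e t ht⟩
      rw [union_insert, ← hv]; rfl

/-- `IsDivisorOf` lets each function choose its own model. Refining `M` by the vertices of `M'`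
gives a model with the vertices, hence the edges, of `M'`; so different functions can be treated on
one model. -/
theorem Linearizes.mono {M M' : Model Γ} {f : Γ → ℝ} {D : Γ →₀ ℤ} (hf : M.Linearizes f D)
    (h : M.verts ⊆ M'.verts) : M'.Linearizes f D := by
  obtain ⟨N, hN, hN'⟩ := M.exists_refinement M'.verts_finite
  rw [union_eq_self_of_subset_left h] at hN
  exact (hN' f D hf).of_verts_eq hN.symm

end Model

end MetricGraph

/-! ### Bridgelessness and the flux of a function through a level. -/

namespace MetricGraph

open Set Filter Topology

variable {Γ : Type*} [MetricSpace Γ]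

/-- No point outside `S` disconnects the space. -/
def Bridgeless (S : Set Γ) : Prop := ∀ p ∉ S, IsPreconnected ({p}ᶜ : Set Γ)

/-- The topological form of 2-edge-connectedness is convenient because it passes to refinements of a
model at once. -/
theorem Bridgeless.mono {S T : Set Γ} (h : Bridgeless S) (hST : S ⊆ T) : Bridgeless T :=
  fun p hp => h p fun hpS => hp (hST hpS)

namespace Model

theorem exists_isPreconnected (M : Model Γ) (x y : Γ) :
    ∃ T : Set Γ, x ∈ T ∧ y ∈ T ∧ IsPreconnected T := by
  have h := (M.dist_isLeast x y).1
  rw [mem_ofPred_eq] at h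
  generalize dist x y = L at h
  induction h with
  | refl x => exact ⟨{x}, rfl, rfl, isPreconnected_singleton⟩
  | step e s t hs ht y L _ ih =>
    obtain ⟨T, h1, h2, h3⟩ := ih
    exact ⟨M.param e '' Icc 0 (M.len e) ∪ T, Or.inl ⟨s, hs, rfl⟩, Or.inr h2,
      (isPreconnected_Icc.image _ (M.continuousOn_param e)).union _ ⟨t, ht, rfl⟩ h1 h3⟩

theorem connectedSpace (M : Model Γ) : ConnectedSpace Γ where
  isPreconnected_univ := isPreconnected_of_forall_pair fun x _ y _ => by
    obtain ⟨T, h1, h2, h3⟩ := M.exists_isPreconnected x y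
    exact ⟨T, subset_univ _, h1, h2, h3⟩
  toNonempty := M.verts_nonempty.to_type

/-- Without an interior point of `e`, the vertices are still joined along the other edges, and the
two remaining pieces of `e` hang on its ends. -/
theorem bridgeless_of_isEdgeConnected (M : Model Γ) (hM : M.IsEdgeConnected 2) :
    Bridgeless M.verts := by
  intro p hp
  obtain ⟨e, t, ht, rfl⟩ := (M.cover p).resolve_left hp
  let R : Γ → Γ → Prop := fun x y =>
    ∃ T : Set Γ, T ⊆ {M.param e t}ᶜ ∧ x ∈ T ∧ y ∈ T ∧ IsPreconnected T
  have Rsymm : ∀ {x y}, R x y → R y x := fun ⟨T, h1, h2, h3, h4⟩ => ⟨T, h1, h3, h2, h4⟩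
  have Rtrans : ∀ {x y z}, R x y → R y z → R x z :=
    fun ⟨T, h1, h2, h3, h4⟩ ⟨T', h1', h2', h3', h4'⟩ =>
      ⟨T ∪ T', union_subset h1 h1', Or.inl h2, Or.inr h3', h4.union _ h3 h2' h4'⟩
  have Redge : ∀ (e' : M.Edge) (I : Set ℝ) (_ : IsPreconnected I) (_ : I ⊆ Icc 0 (M.len e'))
      (_ : e' = e → t ∉ I) (u v : ℝ) (_ : u ∈ I) (_ : v ∈ I),
      R (M.param e' u) (M.param e' v) := by
    intro e' I hI hI' hne u v hu hv
    refine ⟨M.param e' '' I, ?_, ⟨u, hu, rfl⟩, ⟨v, hv, rfl⟩,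
      hI.image _ ((M.continuousOn_param e').mono hI')⟩
    rintro _ ⟨w, hw, rfl⟩ hwt
    have hwt' : M.param e' w = M.param e t := hwt
    have hw' := M.mem_Ioo_of_notMem (hI' hw) (by rw [hwt']; exact hp)
    obtain ⟨rfl, rfl⟩ := M.interior_inj _ _ _ hw' _ ht hwt'
    exact hne rfl hw
  have Rverts : ∀ u ∈ M.verts, ∀ v ∈ M.verts, R u v := by
    intro u hu v hv
    have h := hM {e} (by simp) u hu v hv
    induction h with
    | refl => exact ⟨{u}, by rintro _ rfl h; exact hp (h ▸ hu), rfl, rfl, isPreconnected_singleton⟩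
    | @tail v w _ hvw ih =>
      obtain ⟨e', he', h⟩ := hvw
      have h1 := Redge e' _ isPreconnected_Icc le_rfl (fun h => absurd h he') 0 (M.len e')
        (M.left_mem e') (M.right_mem e')
      rcases h with ⟨rfl, rfl⟩ | ⟨rfl, rfl⟩
      · exact Rtrans (ih (M.src_mem e')) h1
      · exact Rtrans (ih (M.tgt_mem e')) (Rsymm h1)
  have Rpt : ∀ y ∈ ({M.param e t}ᶜ : Set Γ), ∃ v ∈ M.verts, R v y := by
    intro y hy
    rcases M.toPreModel.exists_param_eq y with hy' | ⟨e', u, hu, rfl⟩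
    · exact ⟨y, hy', {y}, singleton_subset_iff.2 hy, rfl, rfl, isPreconnected_singleton⟩
    by_cases hee : e' = e
    · subst hee
      rcases lt_trichotomy u t with h | h | h
      · exact ⟨_, M.src_mem e', Redge e' (Icc 0 u) isPreconnected_Icc
          (Icc_subset_Icc_right hu.2) (fun _ h' => h.not_ge h'.2) _ _ ⟨le_rfl, hu.1⟩ ⟨hu.1, le_rfl⟩⟩
      · subst h; exact absurd rfl hy
      · exact ⟨_, M.tgt_mem e', Redge e' (Icc u (M.len e')) isPreconnected_Icc
          (Icc_subset_Icc_left hu.1) (fun _ h' => h.not_ge h'.1) _ _ ⟨hu.2, le_rfl⟩ ⟨le_rfl, hu.2⟩⟩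
    · exact ⟨_, M.src_mem e', Redge e' _ isPreconnected_Icc le_rfl (fun h => absurd h hee) _ _
        (M.left_mem e') hu⟩
  refine isPreconnected_of_forall (M.src e) fun y hy => ?_
  obtain ⟨v, hv, h⟩ := Rpt y hy
  exact Rtrans (Rverts _ (M.src_mem e) v hv) h

/-- Summation by parts. For `χ` the indicator of a sublevel set, it turns the degree of the divisor
there into the flux of slope across the level. -/
theorem linearCombination_divisor (M : Model Γ) (s : M.Edge → ℤ) (χ : Γ → ℤ) :
    Finsupp.linearCombination ℤ χ (M.divisor s) =
      ∑ e, s e * (χ (M.src e) - χ (M.tgt e)) := by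
  simp only [Model.divisor, map_sum, map_sub, Finsupp.linearCombination_single, smul_eq_mul,
    mul_sub]

theorem IsLinear.tgt {M : Model Γ} {f : Γ → ℝ} {s : M.Edge → ℤ} (h : M.IsLinear f s)
    (e : M.Edge) : f (M.tgt e) = f (M.src e) + s e * M.len e :=
  h e _ (M.right_mem e)

/-- The values of `f` at the ends of the edge are on different sides of `c`. -/
def Crosses (M : Model Γ) (f : Γ → ℝ) (c : ℝ) (e : M.Edge) : Prop :=
  (f (M.src e) < c ∧ c < f (M.tgt e)) ∨ (f (M.tgt e) < c ∧ c < f (M.src e))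

/-- The total slope along any set of crossing edges is bounded by the degree of the divisor of `f`
below the level. -/
theorem sum_abs_le_cut {M : Model Γ} {f : Γ → ℝ} {s : M.Edge → ℤ} (h : M.IsLinear f s) {c : ℝ}
    (A : Finset M.Edge) (hA : ∀ e ∈ A, M.Crosses f c e) :
    ∑ e ∈ A, |s e| ≤
      Finsupp.linearCombination ℤ (fun x => if f x < c then (1 : ℤ) else 0) (M.divisor s) := by
  rw [linearCombination_divisor]
  -- `f` rises along any edge that leaves the sublevel set, so no contributions cancel; a crossing
  -- edge contributes `|s e|`.
  have hpos : ∀ e, 0 ≤ s e * ((if f (M.src e) < c then (1 : ℤ) else 0) -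
      if f (M.tgt e) < c then 1 else 0) := by
    intro e
    have h1 := h.tgt e
    have hl := M.len_pos e
    split_ifs with h2 h3 h3
    · simp
    · have : (0 : ℝ) ≤ s e := by
        by_contra hs
        push Not at hs
        nlinarith
      have : 0 ≤ s e := by exact_mod_cast this
      simpa
    · have : (s e : ℝ) ≤ 0 := by
        by_contra hs
        push Not at hs
        nlinarith
      have : s e ≤ 0 := by exact_mod_cast this
      simpa
    · simp
  refine le_trans (Finset.sum_le_sum fun e he => ?_)
    (Finset.sum_le_sum_of_subset_of_nonneg (Finset.subset_univ A) fun e _ _ => hpos e)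
  have h0 := hpos e
  rcases hA e he with ⟨h1, h2⟩ | ⟨h1, h2⟩
  · rw [if_pos h1, if_neg h2.not_gt] at h0 ⊢
    rw [abs_of_nonneg] <;> linarith
  · rw [if_pos h1, if_neg h2.not_gt] at h0 ⊢
    rw [abs_of_nonpos] <;> linarith

theorem Crosses.slope_ne_zero {M : Model Γ} {f : Γ → ℝ} {s : M.Edge → ℤ} (h : M.IsLinear f s)
    {c : ℝ} {e : M.Edge} (hc : M.Crosses f c e) : s e ≠ 0 := by
  intro h0
  have := h.tgt e
  rw [h0, Int.cast_zero, zero_mul, add_zero] at this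
  rcases hc with h | h <;> linarith

theorem Crosses.exists_mem {M : Model Γ} {f : Γ → ℝ} {s : M.Edge → ℤ} (h : M.IsLinear f s)
    {c : ℝ} {e : M.Edge} (hc : M.Crosses f c e) :
    ∃ t ∈ Ioo 0 (M.len e), f (M.param e t) = c := by
  have hs : (s e : ℝ) ≠ 0 := Int.cast_ne_zero.2 (hc.slope_ne_zero h)
  have h1 := h.tgt e
  have hl := M.len_pos e
  have hmem : (c - f (M.src e)) / s e ∈ Ioo 0 (M.len e) := by
    rcases hc with hc | hc
    · have : (0 : ℝ) < s e := by
        by_contra hs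
        push Not at hs
        nlinarith
      exact ⟨div_pos (by linarith) this, by rw [div_lt_iff₀ this]; linarith⟩
    · have : (s e : ℝ) < 0 := by
        by_contra hs
        push Not at hs
        nlinarith
      exact ⟨div_pos_of_neg_of_neg (by linarith) this, by rw [div_lt_iff_of_neg this]; linarith⟩
  refine ⟨_, hmem, ?_⟩
  rw [h e _ (Ioo_subset_Icc_self hmem)]
  field_simp
  ring

theorem IsLinear.param_inj {M : Model Γ} {f : Γ → ℝ} {s : M.Edge → ℤ} (h : M.IsLinear f s)
    {e : M.Edge} (hs : s e ≠ 0) {t u : ℝ} (ht : t ∈ Icc 0 (M.len e)) (hu : u ∈ Icc 0 (M.len e))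
    (htu : f (M.param e t) = f (M.param e u)) : t = u := by
  rw [h e t ht, h e u hu] at htu
  exact mul_left_cancel₀ (Int.cast_ne_zero.2 hs) (add_left_cancel htu)

theorem IsLinear.crosses {M : Model Γ} {f : Γ → ℝ} {s : M.Edge → ℤ} (h : M.IsLinear f s)
    {e : M.Edge} {t : ℝ} (ht : t ∈ Icc 0 (M.len e)) (hreg : f (M.param e t) ∉ f '' M.verts) :
    t ∈ Ioo 0 (M.len e) ∧ M.Crosses f (f (M.param e t)) e := by
  have ht' := M.mem_Ioo_of_notMem ht fun hv => hreg ⟨_, hv, rfl⟩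
  refine ⟨ht', ?_⟩
  have h1 := h.tgt e
  have h2 := h e t ht
  have hs : (s e : ℝ) ≠ 0 := by
    intro h0
    rw [h0, zero_mul, add_zero] at h2
    exact hreg ⟨_, M.src_mem e, h2.symm⟩
  rcases lt_or_gt_of_ne hs with hs | hs
  · right
    constructor
    · rw [h1, h2]; nlinarith [ht'.2]
    · rw [h2]; nlinarith [ht'.1]
  · left
    constructor
    · rw [h2]; nlinarith [ht'.1]
    · rw [h1, h2]; nlinarith [ht'.2]

/-- Above a regular level and below it there is a cut consisting of at least two edges. -/
theorem exists_two_crosses {M : Model Γ} (hB : Bridgeless M.verts) {f : Γ → ℝ}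
    (hf : Continuous f) {s : M.Edge → ℤ} (h : M.IsLinear f s) {c : ℝ} (hc : c ∉ f '' M.verts)
    {a b : Γ} (ha : f a < c) (hb : c < f b) (e₀ : M.Edge) :
    ∃ e, e ≠ e₀ ∧ M.Crosses f c e := by
  by_contra hne
  push Not at hne
  have hconn := M.connectedSpace
  obtain ⟨p, hp⟩ : ∃ p, f p = c := by
    have := isPreconnected_univ.intermediate_value (mem_univ a) (mem_univ b) hf.continuousOn
    obtain ⟨p, -, hp⟩ := this ⟨ha.le, hb.le⟩
    exact ⟨p, hp⟩
  have key : ∀ z, f z = c → ∃ t ∈ Icc 0 (M.len e₀), M.param e₀ t = z ∧ M.Crosses f c e₀ := by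
    intro z hz
    have hzv : z ∉ M.verts := fun hv => hc ⟨z, hv, hz⟩
    obtain ⟨e, t, ht, rfl⟩ := (M.toPreModel.exists_param_eq z).resolve_left hzv
    have hcr := (h.crosses ht (by rwa [hz])).2
    rw [hz] at hcr
    by_cases he : e = e₀
    · subst he; exact ⟨t, ht, rfl, hcr⟩
    · exact absurd hcr (hne e he)
  -- If only `e₀` crosses, the level is a single point `p`, as `f` is injective on `e₀`. But the
  -- complement of `p` is connected and `f` must take the value `c` on it too.
  have huniq : ∀ z, f z = c → z = p := by
    intro z hz
    obtain ⟨t, ht, rfl, hcr⟩ := key z hz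
    obtain ⟨u, hu, rfl, -⟩ := key p hp
    rw [h.param_inj (hcr.slope_ne_zero h) ht hu (hz.trans hp.symm)]
  have hpv : p ∉ M.verts := fun hv => hc ⟨p, hv, hp⟩
  obtain ⟨z, hz, hz'⟩ := (hB p hpv).intermediate_value (a := a) (b := b)
    (by rintro rfl; exact ha.ne hp) (by rintro rfl; exact hb.ne' hp) hf.continuousOn
    ⟨ha.le, hb.le⟩
  exact hz (huniq z hz')

/-- Two edges cross the level, each with a nonzero integer slope. Divisors of small degree are
controlled by comparison with this bound. -/
theorem two_le_cut {M : Model Γ} (hB : Bridgeless M.verts) {f : Γ → ℝ}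
    (hf : Continuous f) {s : M.Edge → ℤ} (h : M.IsLinear f s) {c : ℝ} (hc : c ∉ f '' M.verts)
    {a b : Γ} (ha : f a < c) (hb : c < f b) :
    2 ≤ Finsupp.linearCombination ℤ (fun x => if f x < c then (1 : ℤ) else 0) (M.divisor s) := by
  classical
  have hE : Nonempty M.Edge := by
    by_contra hE
    rw [not_nonempty_iff] at hE
    have hconn := M.connectedSpace
    obtain ⟨p, -, hp⟩ := isPreconnected_univ.intermediate_value (mem_univ a) (mem_univ b)
      hf.continuousOn ⟨ha.le, hb.le⟩
    rcases M.cover p with h' | ⟨e, -⟩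
    · exact hc ⟨p, h', hp⟩
    · exact hE.elim e
  obtain ⟨e, -, he⟩ := exists_two_crosses hB hf h hc ha hb hE.some
  obtain ⟨e', hne, he'⟩ := exists_two_crosses hB hf h hc ha hb e
  have := sum_abs_le_cut h {e, e'} (c := c) (by simp [he, he'])
  rw [Finset.sum_pair hne.symm] at this
  have h1 := Int.one_le_abs (he.slope_ne_zero h)
  have h2 := Int.one_le_abs (he'.slope_ne_zero h)
  linarith

theorem exists_regular (M : Model Γ) (f : Γ → ℝ) {a b : ℝ} (hab : a < b) :
    ∃ c, a < c ∧ c < b ∧ c ∉ f '' M.verts := by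
  obtain ⟨c, hc, hc'⟩ := ((Ioo_infinite hab).sdiff (M.verts_finite.image f)).nonempty
  exact ⟨c, hc.1, hc.2, hc'⟩

theorem divisor_eq_zero {M : Model Γ} {f : Γ → ℝ} {s : M.Edge → ℤ} (h : M.IsLinear f s)
    (hc : ∀ x y, f x ≤ f y) : M.divisor s = 0 := by
  have : ∀ e, s e = 0 := by
    intro e
    have h1 := h.tgt e
    have h2 : (s e : ℝ) * M.len e = 0 := by linarith [hc (M.src e) (M.tgt e), hc (M.tgt e) (M.src e)]
    exact_mod_cast (mul_eq_zero.1 h2).resolve_right (M.len_pos e).ne'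
  simp [Model.divisor, this]

/-- The edge `e` leaves `v` with positive slope. -/
def Up (M : Model Γ) (s : M.Edge → ℤ) (v : Γ) (e : M.Edge) : Prop :=
  (M.src e = v ∧ 0 < s e) ∨ (M.tgt e = v ∧ s e < 0)

theorem divisor_apply (M : Model Γ) (s : M.Edge → ℤ) (v : Γ) [DecidableEq Γ] :
    M.divisor s v = ∑ e, s e * ((if M.src e = v then 1 else 0) - if M.tgt e = v then 1 else 0) := by
  simp [Model.divisor, Finsupp.single_apply, mul_sub]

theorem exists_up_of_pos {M : Model Γ} {s : M.Edge → ℤ} {v : Γ} (h : 0 < M.divisor s v) :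
    ∃ e, M.Up s v e := by
  classical
  by_contra hne
  push Not at hne
  rw [divisor_apply] at h
  refine absurd h (not_lt.2 (Finset.sum_nonpos fun e _ => ?_))
  have he := hne e
  simp only [Up, not_or, not_and, not_lt] at he
  split_ifs with h1 h2 h2
  · simp
  · simpa using he.1 h1
  · simpa using he.2 h2
  · simp

/-- The edge `e₀` descends from `v` and contributes a negative amount there, which only an ascending
edge can balance. -/
theorem exists_up_of_nonneg {M : Model Γ} {f : Γ → ℝ} {s : M.Edge → ℤ} (hf : M.IsLinear f s)
    {v : Γ} (h : 0 ≤ M.divisor s v) {e₀ : M.Edge} (he₀ : M.Up (fun e => - s e) v e₀) :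
    ∃ e, M.Up s v e := by
  classical
  by_contra hne
  push Not at hne
  rw [divisor_apply] at h
  refine absurd h (not_le.2 (Finset.sum_neg' (fun e _ => ?_) ⟨e₀, Finset.mem_univ _, ?_⟩))
  · have he := hne e
    simp only [Up, not_or, not_and, not_lt] at he
    split_ifs with h1 h2 h2
    · simp
    · simpa using he.1 h1
    · simpa using he.2 h2
    · simp
  · have h1 := hf.tgt e₀
    have hl := M.len_pos e₀
    -- A loop has slope zero because `f` is single-valued, so the two ends of `e₀` cannot cancel
    -- each other at `v`.
    have hloop : M.src e₀ = M.tgt e₀ → s e₀ = 0 := by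
      intro heq
      rw [heq] at h1
      have : (s e₀ : ℝ) * M.len e₀ = 0 := by linarith
      exact_mod_cast (mul_eq_zero.1 this).resolve_right hl.ne'
    rcases he₀ with ⟨h2, h3⟩ | ⟨h2, h3⟩
    · replace h3 : 0 < -s e₀ := h3
      have : M.tgt e₀ ≠ v := fun h => by
        have := hloop (h2.trans h.symm); omega
      rw [if_pos h2, if_neg this]; omega
    · replace h3 : -s e₀ < 0 := h3
      have : M.src e₀ ≠ v := fun h => by
        have := hloop (h.trans h2.symm); omega
      rw [if_pos h2, if_neg this]; omega

end Model

end MetricGraph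

/-! ### Linear equivalence of effective divisors of degree two. -/

namespace MetricGraph

open Set Filter Topology

section Pair

variable {Γ : Type*}

/-- The effective divisor `x + y` of degree two. -/
noncomputable def pairDivisor (x y : Γ) : Γ →₀ ℤ := Finsupp.single x 1 + Finsupp.single y 1

theorem pairDivisor_comm (x y : Γ) : pairDivisor x y = pairDivisor y x := add_comm _ _

theorem linearCombination_pairDivisor (χ : Γ → ℤ) (x y : Γ) :
    Finsupp.linearCombination ℤ χ (pairDivisor x y) = χ x + χ y := by
  simp [pairDivisor]

theorem pairDivisor_apply [DecidableEq Γ] (x y z : Γ) :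
    pairDivisor x y z = (if x = z then 1 else 0) + if y = z then 1 else 0 := by
  simp [pairDivisor, Finsupp.single_apply]

end Pair

variable {Γ : Type*} [MetricSpace Γ]

/-- Including the vertices of `M₀` makes `Bridgeless M₀.verts` available for the model on which `f`
is linear. -/
theorem IsPrincipal.exists_linearizes {D : Γ →₀ ℤ} (h : IsPrincipal D) (M₀ : Model Γ) :
    ∃ (f : Γ → ℝ) (M : Model Γ) (s : M.Edge → ℤ), M₀.verts ⊆ M.verts ∧ Continuous f ∧
      M.IsLinear f s ∧ D = M.divisor s := by
  obtain ⟨f, hf, M, s, hs, hD⟩ := h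
  obtain ⟨M', hM', h'⟩ := M.exists_refinement M₀.verts_finite
  obtain ⟨s', h1, h2⟩ := h' f D ⟨s, hs, hD⟩
  exact ⟨f, M', s', hM' ▸ subset_union_right, hf, h1, h2⟩

theorem IsPrincipal.sub {D D' : Γ →₀ ℤ} (h : IsPrincipal D) (h' : IsPrincipal D') :
    IsPrincipal (D - D') := by
  obtain ⟨f, hf, M, s, hs, hD⟩ := h
  obtain ⟨f', M', s', hM, hf', hs', hD'⟩ := h'.exists_linearizes M
  obtain ⟨t, ht, hDt⟩ := Model.Linearizes.mono ⟨s, hs, hD⟩ hM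
  refine ⟨fun x => f x - f' x, hf.sub hf', M', fun e => t e - s' e, fun e u hu => ?_, ?_⟩
  · simp only [ht e u hu, hs' e u hu]; push_cast; ring
  · rw [hDt, hD', Model.divisor, Model.divisor, Model.divisor, ← Finset.sum_sub_distrib]
    refine Finset.sum_congr rfl fun e _ => ?_
    rw [Finsupp.single_sub, Finsupp.single_sub]; abel

theorem IsPrincipal.sub_comm {D D' : Γ →₀ ℤ} (h : IsPrincipal (D - D')) :
    IsPrincipal (D' - D) := by
  have := (h.sub h).sub h
  simpa using this

theorem IsPrincipal.deg_eq_zero {D : Γ →₀ ℤ} (h : IsPrincipal D) :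
    Finsupp.linearCombination ℤ (fun _ => (1 : ℤ)) D = 0 := by
  obtain ⟨f, hf, M, s, hs, rfl⟩ := h
  simp [Model.linearCombination_divisor]

/-- Distinct points of a bridgeless metric graph are not linearly equivalent. -/
theorem eq_of_isPrincipal {M₀ : Model Γ} (hB : Bridgeless M₀.verts) {x y : Γ}
    (h : IsPrincipal (Finsupp.single x 1 - Finsupp.single y 1)) : x = y := by
  obtain ⟨f, M, s, hM, hf, hs, hD⟩ := h.exists_linearizes M₀
  by_cases hc : ∀ a b, f a ≤ f b
  · rw [Model.divisor_eq_zero hs hc, sub_eq_zero] at hD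
    exact (Finsupp.single_left_inj one_ne_zero).1 hD
  · push Not at hc
    obtain ⟨a, b, hab⟩ := hc
    obtain ⟨c, h1, h2, h3⟩ := M.exists_regular f hab
    -- The degree of `x - y` below any level is at most one.
    have := Model.two_le_cut (hB.mono hM) hf hs h3 h1 h2
    rw [← hD, map_sub, Finsupp.linearCombination_single, Finsupp.linearCombination_single] at this
    simp only [smul_eq_mul, one_mul] at this
    split_ifs at this <;> omega

namespace Model

variable {M : Model Γ} {f : Γ → ℝ} {s : M.Edge → ℤ} {x x' y y' : Γ}

theorem cut_pair_sub_pair (hD : pairDivisor x x' - pairDivisor y y' = M.divisor s) (c : ℝ) :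
    Finsupp.linearCombination ℤ (fun x => if f x < c then (1 : ℤ) else 0) (M.divisor s) =
      ((if f x < c then 1 else 0) + if f x' < c then 1 else 0) -
        ((if f y < c then 1 else 0) + if f y' < c then 1 else 0) := by
  rw [← hD, map_sub, linearCombination_pairDivisor, linearCombination_pairDivisor]

/-- Below a level that lies under `f x`, the divisor `x + x' - y - y'` has degree at most one.
Swapping `x` and `x'` shows that both are minima. -/
theorem le_of_pair (hB : Bridgeless M.verts) (hf : Continuous f) (hs : M.IsLinear f s)
    (hD : pairDivisor x x' - pairDivisor y y' = M.divisor s) (z : Γ) : f x ≤ f z := by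
  by_contra h
  push Not at h
  obtain ⟨c, h1, h2, h3⟩ := M.exists_regular f h
  have := two_le_cut hB hf hs h3 h1 h2
  rw [cut_pair_sub_pair hD, if_neg h2.not_gt] at this
  split_ifs at this <;> omega

/-- Once `y` is below a level it cancels one of the at most two positive points there. -/
theorem le_of_pair' (hB : Bridgeless M.verts) (hf : Continuous f) (hs : M.IsLinear f s)
    (hD : pairDivisor x x' - pairDivisor y y' = M.divisor s) (z : Γ) : f z ≤ f y := by
  by_contra h
  push Not at h
  obtain ⟨c, h1, h2, h3⟩ := M.exists_regular f h
  have := two_le_cut hB hf hs h3 h1 h2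
  rw [cut_pair_sub_pair hD, if_pos h1] at this
  split_ifs at this <;> omega

theorem cut_le_two (hD : pairDivisor x x' - pairDivisor y y' = M.divisor s) (c : ℝ) :
    Finsupp.linearCombination ℤ (fun x => if f x < c then (1 : ℤ) else 0) (M.divisor s) ≤ 2 := by
  rw [cut_pair_sub_pair hD]
  split_ifs <;> omega

/-- The total slope through a level is at most two and is shared by at least two edges. -/
theorem abs_slope_le_one (hB : Bridgeless M.verts) (hf : Continuous f) (hs : M.IsLinear f s)
    (hD : pairDivisor x x' - pairDivisor y y' = M.divisor s) (e : M.Edge) : |s e| ≤ 1 := by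
  classical
  by_cases h0 : s e = 0
  · simp [h0]
  have hne : f (M.src e) ≠ f (M.tgt e) := by
    intro h
    exact (M.len_pos e).ne (hs.param_inj h0 (M.left_mem e) (M.right_mem e) h)
  obtain ⟨c, a, b, ha, hb, hreg, hcr⟩ : ∃ c a b, f a < c ∧ c < f b ∧ c ∉ f '' M.verts ∧
      M.Crosses f c e := by
    rcases lt_or_gt_of_ne hne with h | h
    · obtain ⟨c, h1, h2, h3⟩ := M.exists_regular f h
      exact ⟨c, _, _, h1, h2, h3, Or.inl ⟨h1, h2⟩⟩
    · obtain ⟨c, h1, h2, h3⟩ := M.exists_regular f h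
      exact ⟨c, _, _, h1, h2, h3, Or.inr ⟨h1, h2⟩⟩
  obtain ⟨e', hne', hcr'⟩ := exists_two_crosses hB hf hs hreg ha hb e
  have h1 := (sum_abs_le_cut hs {e, e'} (c := c) (by simp [hcr, hcr'])).trans (cut_le_two hD c)
  rw [Finset.sum_pair hne'.symm] at h1
  have h2 := Int.one_le_abs (hcr'.slope_ne_zero hs)
  linarith

theorem lipschitz_of_pair (hB : Bridgeless M.verts) (hf : Continuous f) (hs : M.IsLinear f s)
    (hD : pairDivisor x x' - pairDivisor y y' = M.divisor s) (a b : Γ) :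
    |f a - f b| ≤ dist a b := by
  rw [← Real.dist_eq]
  refine M.dist_le_of_edges (fun e t ht u hu => ?_) a b
  rw [hs e t ht, hs e u hu, Real.dist_eq, add_sub_add_left_eq_sub, ← mul_sub, abs_mul]
  refine mul_le_of_le_one_left (abs_nonneg _) ?_
  exact_mod_cast abs_slope_le_one hB hf hs hD e

/-- Greedy ascent, by induction on the number of vertices above `v`. At a vertex other than `y` and
`y'` the divisor is nonnegative, so an edge arriving from below is followed by one going up. Nonzero
slopes have absolute value at least one, so the length is at most the gain of `f`. -/
theorem exists_dist_le_of_up (hs : M.IsLinear f s)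
    (hD : pairDivisor x x' - pairDivisor y y' = M.divisor s) (n : ℕ) :
    ∀ v : Γ, {u ∈ M.verts | f v < f u}.ncard ≤ n → (∃ e, M.Up s v e) →
      ∃ w, (w = y ∨ w = y') ∧ dist v w ≤ f w - f v := by
  classical
  induction n with
  | zero =>
    rintro v hv ⟨e, he⟩
    exfalso
    have hfin : {u ∈ M.verts | f v < f u}.Finite := M.verts_finite.subset fun _ h => h.1
    rw [Nat.le_zero, ncard_eq_zero hfin] at hv
    have h1 := hs.tgt e
    have hl := M.len_pos e
    rcases he with ⟨rfl, h3⟩ | ⟨rfl, h3⟩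
    · have h3' : (0 : ℝ) < s e := by exact_mod_cast h3
      exact hv.subset (show M.tgt e ∈ _ from ⟨M.tgt_mem e, by nlinarith⟩)
    · have h3' : (s e : ℝ) < 0 := by exact_mod_cast h3
      exact hv.subset (show M.src e ∈ _ from ⟨M.src_mem e, by nlinarith⟩)
  | succ n ih =>
    rintro v hv ⟨e, he⟩
    obtain ⟨u, hu, hd, hlt, hdown⟩ : ∃ u ∈ M.verts, dist v u ≤ f u - f v ∧ f v < f u ∧
        M.Up (fun e => - s e) u e := by
      have h1 := hs.tgt e
      have hl := M.len_pos e
      have h2 := M.dist_param_le e (M.left_mem e) (M.right_mem e)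
      rw [zero_sub, abs_neg, abs_of_pos hl] at h2
      rcases he with ⟨rfl, h3⟩ | ⟨rfl, h3⟩
      · have h3' : (1 : ℝ) ≤ s e := by exact_mod_cast h3
        refine ⟨_, M.tgt_mem e, ?_, ?_, Or.inr ⟨rfl, by simpa using h3⟩⟩
        · refine h2.trans ?_
          rw [h1]; nlinarith
        · nlinarith
      · have h3' : (s e : ℝ) ≤ -1 := by
          have : s e ≤ -1 := by omega
          exact_mod_cast this
        refine ⟨_, M.src_mem e, ?_, ?_, Or.inl ⟨rfl, by simpa using h3⟩⟩
        · rw [dist_comm]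
          refine h2.trans ?_
          rw [h1]; nlinarith
        · nlinarith
    by_cases hy : u = y ∨ u = y'
    · exact ⟨u, hy, hd⟩
    · rw [not_or] at hy
      have hDu : 0 ≤ M.divisor s u := by
        rw [← hD, Finsupp.sub_apply, pairDivisor_apply, pairDivisor_apply,
          if_neg (Ne.symm hy.1), if_neg (Ne.symm hy.2)]
        split_ifs <;> simp
      obtain ⟨w, hw, hw'⟩ := ih u (by
        have : {z ∈ M.verts | f u < f z}.ncard < {z ∈ M.verts | f v < f z}.ncard := by
          refine ncard_lt_ncard ⟨fun z hz => ⟨hz.1, hlt.trans hz.2⟩, fun h => ?_⟩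
            (M.verts_finite.subset fun _ h => h.1)
          exact lt_irrefl _ (h (show u ∈ _ from ⟨hu, hlt⟩)).2
        omega) (exists_up_of_nonneg hs hDu hdown)
      exact ⟨w, hw, (dist_triangle _ _ _).trans (by linarith)⟩

/-- Following a function with divisor `x + x' - y - y'` upwards from `x` one gets
to `y` or `y'`. -/
theorem exists_dist_le_of_pair (hB : Bridgeless M.verts) (hf : Continuous f)
    (hs : M.IsLinear f s) (hD : pairDivisor x x' - pairDivisor y y' = M.divisor s)
    (hxy : f x < f y) : ∃ w, (w = y ∨ w = y') ∧ dist x w ≤ f w - f x := by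
  classical
  refine exists_dist_le_of_up hs hD _ x le_rfl (exists_up_of_pos ?_)
  have h1 : y ≠ x := by rintro rfl; exact lt_irrefl _ hxy
  have h2 : y' ≠ x := by
    intro h
    have := le_of_pair' hB hf hs (by rwa [pairDivisor_comm y y'] at hD) y
    rw [h] at this
    exact absurd hxy (not_lt.2 this)
  rw [← hD, Finsupp.sub_apply, pairDivisor_apply, pairDivisor_apply, if_pos rfl, if_neg h1,
    if_neg h2]
  split_ifs <;> simp

theorem IsLinear.neg (hs : M.IsLinear f s) : M.IsLinear (fun z => - f z) (fun e => - s e) := by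
  intro e t ht
  simp only [hs e t ht]
  push_cast
  ring

theorem divisor_neg (M : Model Γ) (s : M.Edge → ℤ) :
    M.divisor (fun e => - s e) = - M.divisor s := by
  simp only [Model.divisor, Finsupp.single_neg, ← Finset.sum_neg_distrib]
  exact Finset.sum_congr rfl fun e _ => by abel

end Model

/-- If `x + x' ~ y + y'` and `y` is close to `x` then `y'` is as close to `x'`. -/
theorem dist_le_of_isPrincipal {M₀ : Model Γ} (hB : Bridgeless M₀.verts) {x x' y y' : Γ}
    (h : IsPrincipal (pairDivisor x x' - pairDivisor y y'))
    (hd : x ≠ x' → dist x y < dist x x' / 2) : dist x' y' ≤ dist x y := by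
  classical
  obtain ⟨f, M, s, hM, hf, hs, hD⟩ := h.exists_linearizes M₀
  replace hB := hB.mono hM
  have hDx : pairDivisor x' x - pairDivisor y y' = M.divisor s := by rwa [pairDivisor_comm x' x]
  have hDxy : pairDivisor x' x - pairDivisor y' y = M.divisor s := by
    rwa [pairDivisor_comm x' x, pairDivisor_comm y' y]
  by_cases hc : f x < f y
  · have hlip := Model.lipschitz_of_pair hB hf hs hD
    have hx' : f x' = f x := le_antisymm (Model.le_of_pair hB hf hs hDx x)
      (Model.le_of_pair hB hf hs hD x')
    have hy' : f y' = f y := le_antisymm (Model.le_of_pair' hB hf hs hD y')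
      (Model.le_of_pair' hB hf hs hDxy y)
    have hxy : f y - f x ≤ dist x y := by
      have := hlip y x
      rw [dist_comm] at this
      exact (le_abs_self _).trans this
    -- If `x = x'`, the descent from `y'` can only end at `x`. Otherwise the ascent from `x'` ends
    -- at `y'`: ending at `y` would give `dist x x' ≤ 2 * dist x y`.
    by_cases hxx : x = x'
    · subst hxx
      have hD' : pairDivisor y' y - pairDivisor x x = M.divisor (fun e => - s e) := by
        rw [Model.divisor_neg, ← hDxy]; abel
      obtain ⟨w, hw, hw'⟩ := Model.exists_dist_le_of_pair (f := fun z => - f z) hB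
        hf.neg hs.neg hD' (neg_lt_neg (by rw [hy']; exact hc))
      have : w = x := hw.elim id id
      subst this
      rw [dist_comm]
      linarith
    · obtain ⟨w, hw, hw'⟩ := Model.exists_dist_le_of_pair hB hf hs hDx (by rw [hx']; exact hc)
      rcases hw with rfl | rfl
      · have := hd hxx
        have h2 := dist_triangle x w x'
        rw [dist_comm w x'] at h2
        linarith
      · linarith
  -- Here the maximum of `f` does not exceed its minimum, so `f` is constant and `x + x' = y + y'`
  -- as divisors.
  · have hconst : ∀ a b, f a ≤ f b := fun a b =>
      (Model.le_of_pair' hB hf hs hD a).trans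
        ((not_lt.1 hc).trans (Model.le_of_pair hB hf hs hD b))
    rw [Model.divisor_eq_zero hs hconst, sub_eq_zero] at hD
    have h1 := DFunLike.congr_fun hD x
    rw [pairDivisor_apply, pairDivisor_apply] at h1
    by_cases hxy : x = y
    · subst hxy
      have : x' = y' := by
        rw [pairDivisor, pairDivisor, add_right_inj] at hD
        exact (Finsupp.single_left_inj one_ne_zero).1 hD
      simp [this]
    · have hyx : y' = x := by
        by_contra hne
        rw [if_pos rfl, if_neg (Ne.symm hxy), if_neg hne] at h1
        split_ifs at h1 <;> omega
      subst hyx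
      have : x' = y := by
        rw [pairDivisor_comm y y', pairDivisor, pairDivisor, add_right_inj] at hD
        exact (Finsupp.single_left_inj one_ne_zero).1 hD
      rw [this, dist_comm]

end MetricGraph

/-! ### The hyperelliptic involution and its quotient. -/

namespace MetricGraph

open Set Filter Topology

variable {Γ : Type*} [MetricSpace Γ]

theorem Model.Crosses.exists_lt {M : Model Γ} {f : Γ → ℝ} {s : M.Edge → ℤ}
    (hs : M.IsLinear f s) {c : ℝ} {e : M.Edge} (hc : M.Crosses f c e) {t : ℝ}
    (ht : t ∈ Ioo 0 (M.len e)) (hft : f (M.param e t) = c) {δ : ℝ} (hδ : 0 < δ) :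
    ∃ u ∈ Icc 0 (M.len e), dist (M.param e t) (M.param e u) < δ ∧ f (M.param e u) < c := by
  have htI := Ioo_subset_Icc_self ht
  have h0 := hc.slope_ne_zero hs
  obtain ⟨u, hu, hut, hlt⟩ : ∃ u ∈ Icc 0 (M.len e), |t - u| < δ ∧ s e * (u - t) < (0 : ℝ) := by
    rcases lt_or_gt_of_ne h0 with h | h
    · have h' : (s e : ℝ) < 0 := by exact_mod_cast h
      have hε : 0 < min δ (M.len e - t) := lt_min hδ (by linarith [ht.2])
      have h1 := min_le_left δ (M.len e - t)
      have h2 := min_le_right δ (M.len e - t)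
      refine ⟨t + min δ (M.len e - t) / 2, ⟨by linarith [ht.1], by linarith⟩, ?_, ?_⟩
      · rw [abs_lt]; constructor <;> linarith
      · rw [add_sub_cancel_left]; exact mul_neg_of_neg_of_pos h' (by linarith)
    · have h' : (0 : ℝ) < s e := by exact_mod_cast h
      have hε : 0 < min δ t := lt_min hδ ht.1
      have h1 := min_le_left δ t
      have h2 := min_le_right δ t
      refine ⟨t - min δ t / 2, ⟨by linarith, by linarith [ht.2]⟩, ?_, ?_⟩
      · rw [abs_lt]; constructor <;> linarith
      · exact mul_neg_of_pos_of_neg h' (by linarith)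
  refine ⟨u, hu, (M.dist_param_le e htI hu).trans_lt hut, ?_⟩
  rw [← hft, hs e u hu, hs e t htI]
  linarith

/-- A regular level of a function with divisor `x + x' - y - y'` consists of two points `p` and
`q` with `x + x' ~ p + q`. -/
theorem exists_level_pair {M : Model Γ} (hB : Bridgeless M.verts) {f : Γ → ℝ}
    (hf : Continuous f) {s : M.Edge → ℤ} (hs : M.IsLinear f s) {x x' y y' : Γ}
    (hD : pairDivisor x x' - pairDivisor y y' = M.divisor s) {c : ℝ} (hc : c ∉ f '' M.verts)
    (hx : f x < c) (hy : c < f y) :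
    ∃ p q, (∀ z, f z = c → z = p ∨ z = q) ∧
      IsPrincipal (pairDivisor x x' - pairDivisor p q) := by
  classical
  have hDx : pairDivisor x' x - pairDivisor y y' = M.divisor s := by rwa [pairDivisor_comm x' x]
  have hDy : pairDivisor x x' - pairDivisor y' y = M.divisor s := by rwa [pairDivisor_comm y' y]
  have hx' : f x' < c := (Model.le_of_pair hB hf hs hDx x).trans_lt hx
  have hy' : c < f y' := hy.trans_le (Model.le_of_pair' hB hf hs hDy y)
  have hE : Nonempty M.Edge := by
    by_contra hE
    rw [not_nonempty_iff] at hE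
    have : M.divisor s = 0 := by simp [Model.divisor]
    have h := Model.cut_pair_sub_pair (f := f) hD c
    rw [this, map_zero, if_pos hx, if_pos hx', if_neg hy.not_gt, if_neg hy'.not_gt] at h
    omega
  obtain ⟨e₁, -, h₁⟩ := Model.exists_two_crosses hB hf hs hc hx hy hE.some
  obtain ⟨e₂, hne, h₂⟩ := Model.exists_two_crosses hB hf hs hc hx hy e₁
  -- A third crossing edge would bring the total slope to three, but it is at most two.
  have honly : ∀ e, M.Crosses f c e → e = e₁ ∨ e = e₂ := by
    intro e he
    by_contra h
    rw [not_or] at h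
    have := (Model.sum_abs_le_cut hs {e, e₁, e₂} (c := c) (by simp [he, h₁, h₂])).trans
      (Model.cut_le_two hD c)
    rw [Finset.sum_insert (by simp [h]), Finset.sum_pair hne.symm] at this
    have k1 := Int.one_le_abs (he.slope_ne_zero hs)
    have k2 := Int.one_le_abs (h₁.slope_ne_zero hs)
    have k3 := Int.one_le_abs (h₂.slope_ne_zero hs)
    linarith
  obtain ⟨t₁, ht₁, hf₁⟩ := h₁.exists_mem hs
  obtain ⟨t₂, ht₂, hf₂⟩ := h₂.exists_mem hs
  set p := M.param e₁ t₁ with hp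
  set q := M.param e₂ t₂ with hq
  have hpq : p ≠ q := fun h => hne (M.interior_inj _ _ _ ht₂ _ ht₁ h.symm).1
  have hlev : ∀ z, f z = c → z = p ∨ z = q := by
    intro z hz
    have hzv : z ∉ M.verts := fun hv => hc ⟨z, hv, hz⟩
    obtain ⟨e, t, ht, rfl⟩ := (M.toPreModel.exists_param_eq z).resolve_left hzv
    have hcr := (hs.crosses ht (by rwa [hz])).2
    rw [hz] at hcr
    rcases honly e hcr with rfl | rfl
    · left; rw [hp, hs.param_inj (hcr.slope_ne_zero hs) ht (Ioo_subset_Icc_self ht₁)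
        (hz.trans hf₁.symm)]
    · right; rw [hq, hs.param_inj (hcr.slope_ne_zero hs) ht (Ioo_subset_Icc_self ht₂)
        (hz.trans hf₂.symm)]
  refine ⟨p, q, hlev, ?_⟩
  -- With `p` and `q` as vertices, `min f c` is linear on edges. Its divisor is `x + x'` below the
  -- level and zero above it, so only the coefficients at `p` and `q` remain.
  obtain ⟨M', hM', hlin⟩ := M.exists_refinement (S := {p, q}) (by simp)
  obtain ⟨s', hs', hD'⟩ := hlin f _ ⟨s, hs, rfl⟩
  have hpM : p ∈ M'.verts := by rw [hM']; simp
  have hqM : q ∈ M'.verts := by rw [hM']; simp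
  -- no edge of the refined model crosses the level
  have hnc : ∀ e, ¬ M'.Crosses f c e := by
    intro e he
    obtain ⟨t, ht, hft⟩ := he.exists_mem hs'
    refine M'.interior_notMem e t ht ?_
    rcases hlev _ hft with h | h <;> rw [h] <;> assumption
  let s'' : M'.Edge → ℤ := fun e => if f (M'.src e) < c ∨ f (M'.tgt e) < c then s' e else 0
  have hg : M'.IsLinear (fun z => min (f z) c) s'' := by
    intro e t ht
    have h1 := hs' e t ht
    have h2 := hs'.tgt e
    have hl := M'.len_pos e
    have h3 := hnc e
    simp only [Model.Crosses, not_or, not_and, not_lt] at h3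
    have hconv : ∀ d : ℝ, f (M'.src e) ≤ d → f (M'.tgt e) ≤ d → f (M'.param e t) ≤ d := by
      intro d h4 h5
      rw [h1]
      rcases le_total (0 : ℝ) (s' e) with h | h
      · nlinarith [ht.2]
      · nlinarith [ht.1]
    have hconv' : ∀ d : ℝ, d ≤ f (M'.src e) → d ≤ f (M'.tgt e) → d ≤ f (M'.param e t) := by
      intro d h4 h5
      rw [h1]
      rcases le_total (0 : ℝ) (s' e) with h | h
      · nlinarith [ht.1]
      · nlinarith [ht.2]
    by_cases h : f (M'.src e) < c ∨ f (M'.tgt e) < c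
    · have h4 : f (M'.src e) ≤ c := by
        rcases h with h | h
        · exact h.le
        · exact h3.2 h
      have h5 : f (M'.tgt e) ≤ c := by
        rcases h with h | h
        · exact h3.1 h
        · exact h.le
      simp only [s'', if_pos h]
      rw [min_eq_left (hconv c h4 h5), min_eq_left h4, h1]
    · simp only [s'', if_neg h]
      rw [not_or, not_lt, not_lt] at h
      rw [min_eq_right (hconv' c h.1 h.2), min_eq_right h.1, Int.cast_zero, zero_mul, add_zero]
  have hprinc : IsPrincipal (M'.divisor s'') := ⟨_, hf.min continuous_const, M', s'', hg, rfl⟩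
  have hlow : ∀ z, f z < c → M'.divisor s'' z = pairDivisor x x' z := by
    intro z hz
    have h1 : M'.divisor s'' z = M'.divisor s' z := by
      rw [Model.divisor_apply, Model.divisor_apply]
      refine Finset.sum_congr rfl fun e _ => ?_
      by_cases h1 : M'.src e = z
      · simp [s'', h1, hz]
      · by_cases h2 : M'.tgt e = z
        · simp [s'', h2, hz]
        · simp [h1, h2]
    rw [h1, ← hD', ← hD, Finsupp.sub_apply, pairDivisor_apply y, if_neg, if_neg]
    · simp
    · rintro rfl; linarith
    · rintro rfl; linarith
  have hhigh : ∀ z, c < f z → M'.divisor s'' z = 0 := by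
    intro z hz
    rw [Model.divisor_apply]
    refine Finset.sum_eq_zero fun e _ => ?_
    have h3 := hnc e
    simp only [Model.Crosses, not_or, not_and, not_lt] at h3
    by_cases h1 : M'.src e = z
    · have h4 : ¬ f (M'.tgt e) < c := fun h => absurd (h3.2 h) (not_le.2 (h1 ▸ hz))
      simp [s'', h1, hz.not_gt, h4]
    · by_cases h2 : M'.tgt e = z
      · have h4 : ¬ f (M'.src e) < c := fun h => absurd (h3.1 h) (not_le.2 (h2 ▸ hz))
        simp [s'', h2, hz.not_gt, h4]
      · simp [h1, h2]
  -- At such a point of the level an edge of the truncation goes down and none goes up.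
  have hat : ∀ z ∈ M'.verts, f z = c → (∀ δ > 0, ∃ w, dist z w < δ ∧ f w < c) →
      M'.divisor s'' z ≤ -1 := by
    intro z hzM hz hw
    obtain ⟨δ, hδ, -, -, -, hstar⟩ := M'.exists_star
    obtain ⟨w, hw1, hw2⟩ := hw δ hδ
    obtain ⟨e, he, t, ht, rfl⟩ := (hstar z hzM w hw1).resolve_left (by rintro rfl; linarith)
    by_contra hneg
    have hno : ¬ ∃ e, M'.Up s'' z e := by
      rintro ⟨e, he⟩
      have h2 := hs'.tgt e
      have hl := M'.len_pos e
      by_cases h : f (M'.src e) < c ∨ f (M'.tgt e) < c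
      · rcases he with ⟨h3, h4⟩ | ⟨h3, h4⟩
        · simp only [s'', if_pos h] at h4
          have h4' : (0 : ℝ) < s' e := by exact_mod_cast h4
          rw [h3, hz] at h2 h
          have := h.resolve_left (lt_irrefl _)
          nlinarith
        · simp only [s'', if_pos h] at h4
          have h4' : (s' e : ℝ) < 0 := by exact_mod_cast h4
          rw [h3, hz] at h2 h
          have := h.resolve_right (lt_irrefl _)
          nlinarith
      · simp [Model.Up, s'', h] at he
    refine hno (Model.exists_up_of_nonneg (e₀ := e) hg (by omega) ?_)
    have h1 := hs' e t ht
    have h2 := hs'.tgt e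
    have hl := M'.len_pos e
    rw [h1] at hw2
    rcases he with he | he
    · rw [he, hz] at hw2
      have h4 : (s' e : ℝ) < 0 := by
        by_contra h; push Not at h; nlinarith [ht.1]
      have h5 : s' e < 0 := by exact_mod_cast h4
      rw [he, hz] at h2
      have h6 : f (M'.tgt e) < c := by nlinarith
      exact Or.inl ⟨he, by simp [s'', h6, h5]⟩
    · rw [he, hz] at h2
      have h4 : (0 : ℝ) < s' e := by
        by_contra h; push Not at h; nlinarith [ht.2]
      have h5 : 0 < s' e := by exact_mod_cast h4
      have h6 : f (M'.src e) < c := by nlinarith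
      exact Or.inr ⟨he, by simp [s'', h6, h5]⟩
  have hp1 : M'.divisor s'' p ≤ -1 := hat p hpM hf₁ fun δ hδ => by
    obtain ⟨u, -, h1, h2⟩ := h₁.exists_lt hs ht₁ hf₁ hδ
    exact ⟨_, h1, h2⟩
  have hq1 : M'.divisor s'' q ≤ -1 := hat q hqM hf₂ fun δ hδ => by
    obtain ⟨u, -, h1, h2⟩ := h₂.exists_lt hs ht₂ hf₂ hδ
    exact ⟨_, h1, h2⟩
  -- the divisor of the truncation
  have hshape : M'.divisor s'' = pairDivisor x x' + (Finsupp.single p (M'.divisor s'' p) +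
      Finsupp.single q (M'.divisor s'' q)) := by
    have hne' : ∀ w z : Γ, f w < f z → w ≠ z := by rintro w _ h rfl; exact lt_irrefl _ h
    ext z
    rw [Finsupp.add_apply, Finsupp.add_apply, Finsupp.single_apply, Finsupp.single_apply]
    rcases lt_trichotomy (f z) c with h | h | h
    · rw [hlow z h, if_neg (hne' z p (hf₁ ▸ h)).symm, if_neg (hne' z q (hf₂ ▸ h)).symm]; ring
    · rw [pairDivisor_apply, if_neg (hne' x z (h ▸ hx)), if_neg (hne' x' z (h ▸ hx'))]
      rcases hlev z h with rfl | rfl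
      · rw [if_pos rfl, if_neg hpq.symm]; ring
      · rw [if_pos rfl, if_neg hpq]; ring
    · rw [hhigh z h, if_neg (hne' p z (hf₁.trans_lt h)), if_neg (hne' q z (hf₂.trans_lt h)),
        pairDivisor_apply, if_neg (hne' x z (hx.trans h)), if_neg (hne' x' z (hx'.trans h))]
      ring
  -- Since the degree is zero, two coefficients that are at most `-1` are both `-1`.
  have hdeg := hprinc.deg_eq_zero
  rw [hshape, map_add, map_add, linearCombination_pairDivisor,
    Finsupp.linearCombination_single, Finsupp.linearCombination_single, smul_eq_mul,
    smul_eq_mul, mul_one, mul_one] at hdeg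
  have hp2 : M'.divisor s'' p = -1 := by omega
  have hq2 : M'.divisor s'' q = -1 := by omega
  rw [hshape, hp2, hq2] at hprinc
  convert hprinc using 1
  rw [pairDivisor, pairDivisor, Finsupp.single_neg, Finsupp.single_neg]
  abel

/-- A map that locally does not increase the distances from a given point does not increase
distances. -/
theorem dist_map_le_of_local (M : Model Γ) {φ : Γ → Γ}
    (h : ∀ x, ∃ r > 0, ∀ y, dist x y < r → dist (φ x) (φ y) ≤ dist x y) (x y : Γ) :
    dist (φ x) (φ y) ≤ dist x y := by
  have hcont : Continuous φ := by
    rw [continuous_iff_continuousAt]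
    intro x
    rw [Metric.continuousAt_iff]
    intro ε hε
    obtain ⟨r, hr, hx⟩ := h x
    refine ⟨min r ε, lt_min hr hε, fun y hy => ?_⟩
    rw [dist_comm] at hy ⊢
    exact (hx y (hy.trans_le (min_le_left _ _))).trans_lt (hy.trans_le (min_le_right _ _))
  have key : ∀ e, ∀ a ∈ Icc 0 (M.len e), ∀ b ∈ Icc 0 (M.len e), a ≤ b →
      dist (φ (M.param e a)) (φ (M.param e b)) ≤ b - a := by
    intro e a ha b hb hab
    have hsub : Icc a b ⊆ Icc 0 (M.len e) := Icc_subset_Icc ha.1 hb.2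
    have hγ : ContinuousOn (fun t => φ (M.param e t)) (Icc a b) :=
      hcont.comp_continuousOn ((M.continuousOn_param e).mono hsub)
    -- Continuous induction along the edge: the radius `r` depends on the centre, but the set where
    -- the estimate from `a` holds is closed and can be extended to the right.
    have hcl : IsClosed ({t | dist (φ (M.param e a)) (φ (M.param e t)) ≤ t - a} ∩ Icc a b) := by
      rw [inter_comm]
      exact isClosed_Icc.isClosed_le
        ((continuous_const.dist continuous_id).comp_continuousOn hγ) (by fun_prop : ContinuousOn (fun t => t - a) (Icc a b))
    refine hcl.Icc_subset_of_forall_exists_gt (by simp) (fun t ht w hw => ?_) ⟨hab, le_rfl⟩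
    obtain ⟨r, hr, hr'⟩ := h (M.param e t)
    have hw' : t < w := hw
    have h1 : t < min (t + r / 2) (min w b) := lt_min (by linarith) (lt_min hw' ht.2.2)
    have h2 : min (t + r / 2) (min w b) ≤ b := (min_le_right _ _).trans (min_le_right _ _)
    have h3 : min (t + r / 2) (min w b) ≤ t + r / 2 := min_le_left _ _
    refine ⟨min (t + r / 2) (min w b), ?_, h1, (min_le_right _ _).trans (min_le_left _ _)⟩
    have h4 := M.dist_param_le e (hsub (Ico_subset_Icc_self ht.2))
      (hsub ⟨ht.2.1.trans h1.le, h2⟩)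
    rw [abs_of_neg (by linarith)] at h4
    have h5 := hr' (M.param e (min (t + r / 2) (min w b))) (by linarith)
    have h6 : dist (φ (M.param e a)) (φ (M.param e t)) ≤ t - a := ht.1
    have h7 := dist_triangle (φ (M.param e a)) (φ (M.param e t))
      (φ (M.param e (min (t + r / 2) (min w b))))
    show dist (φ (M.param e a)) (φ (M.param e (min (t + r / 2) (min w b)))) ≤
      min (t + r / 2) (min w b) - a
    linarith
  refine M.dist_le_of_edges (fun e s hs t ht => ?_) x y
  rcases le_total s t with h' | h'
  · rw [abs_sub_comm, abs_of_nonneg (by linarith)]; exact key e s hs t ht h'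
  · rw [dist_comm, abs_of_nonneg (by linarith)]; exact key e t ht s hs h'

theorem exists_eq_single {X : Type*} {E : X →₀ ℤ} (hE : 0 ≤ E)
    (hdeg : Finsupp.linearCombination ℤ (fun _ => (1 : ℤ)) E = 1) :
    ∃ y, E = Finsupp.single y 1 := by
  classical
  simp only [Finsupp.linearCombination_apply, Finsupp.sum, smul_eq_mul, mul_one] at hdeg
  obtain ⟨y, hy, hy'⟩ : ∃ y ∈ E.support, E y ≠ 0 :=
    Finset.exists_ne_zero_of_sum_ne_zero (by omega)
  have hpos : ∀ z, 0 ≤ E z := hE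
  have h1 := Finset.add_sum_erase _ E hy
  have h2 : 0 ≤ ∑ z ∈ E.support.erase y, E z := Finset.sum_nonneg fun z _ => hpos z
  have h3 := hpos y
  have h4 : ∑ z ∈ E.support.erase y, E z = 0 := by omega
  rw [Finset.sum_eq_zero_iff_of_nonneg fun z _ => hpos z] at h4
  refine ⟨y, ?_⟩
  ext z
  rw [Finsupp.single_apply]
  split_ifs with h
  · subst h; omega
  · by_contra hz
    exact hz (h4 z (Finset.mem_erase.2 ⟨Ne.symm h, Finsupp.mem_support_iff.2 hz⟩))

/-- A hyperelliptic bridgeless metric graph has an involution whose orbits, seen as divisors, are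
all linearly equivalent. -/
theorem exists_involution {M : Model Γ} (hB : Bridgeless M.verts) (hhyp : IsHyperelliptic Γ) :
    ∃ i : Γ ≃ᵢ Γ, IsInvolution i ∧
      ∀ x y, IsPrincipal (pairDivisor x (i x) - pairDivisor y (i y)) := by
  classical
  obtain ⟨D, hdeg, hrank, -⟩ := hhyp
  have hdegD : Finsupp.linearCombination ℤ (fun _ => (1 : ℤ)) D = 2 := by
    simpa [deg, Finsupp.linearCombination_apply] using hdeg
  -- By the rank condition `D - x` is equivalent to an effective divisor of degree one, i.e. to a
  -- point.
  have key : ∀ x, ∃ y, IsPrincipal (D - pairDivisor x y) := by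
    intro x
    obtain ⟨E, hE, hEx⟩ := hrank (Finsupp.single x 1)
      (by intro z; rw [Finsupp.single_apply]; split_ifs <;> simp) (by simp [deg])
    have h1 := IsPrincipal.deg_eq_zero hEx
    rw [map_sub, map_sub, hdegD, Finsupp.linearCombination_single] at h1
    obtain ⟨y, rfl⟩ := exists_eq_single hE (by simp at h1; omega)
    refine ⟨y, ?_⟩
    rw [pairDivisor, ← sub_sub]
    exact hEx
  choose i hi using key
  have hpair : ∀ x y, IsPrincipal (pairDivisor x (i x) - pairDivisor y (i y)) := by
    intro x y
    have := (hi y).sub (hi x)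
    rwa [sub_sub_sub_cancel_left] at this
  have hinv : ∀ x, i (i x) = x := by
    intro x
    refine eq_of_isPrincipal hB ?_
    have := hpair (i x) x
    rw [pairDivisor_comm x, pairDivisor, pairDivisor, add_sub_add_left_eq_sub] at this
    exact this
  have hle : ∀ x y, dist (i x) (i y) ≤ dist x y := by
    refine dist_map_le_of_local M fun x => ?_
    by_cases hx : x = i x
    · exact ⟨1, one_pos, fun y _ => dist_le_of_isPrincipal hB (hpair x y) fun h => absurd hx h⟩
    · exact ⟨dist x (i x) / 2, half_pos (dist_pos.2 hx), fun y hy =>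
        dist_le_of_isPrincipal hB (hpair x y) fun _ => hy⟩
  have hiso : Isometry i := Isometry.of_dist_eq fun x y => by
    refine le_antisymm (hle x y) ?_
    have := hle (i x) (i y)
    rwa [hinv, hinv] at this
  exact ⟨IsometryEquiv.mk' i i hinv hiso, hinv, hpair⟩

/-- No point cuts the circle, whereas in the quotient two orbits will be separated by a single one.
-/
theorem isPreconnected_compl_singleton_circle (z : Circle) : IsPreconnected ({z}ᶜ : Set Circle) := by
  have h : ({z}ᶜ : Set Circle) = (fun t : ℝ => z * Circle.exp t) '' Ioo 0 (2 * Real.pi) := by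
    ext w
    simp only [mem_compl_iff, mem_singleton_iff, mem_image]
    have hpi := Real.pi_pos
    constructor
    · intro hw
      set a := Complex.arg ((z⁻¹ * w : Circle) : ℂ) with ha
      have hexp : Circle.exp a = z⁻¹ * w := Circle.exp_arg _
      have h1 : -Real.pi < a := Complex.neg_pi_lt_arg _
      have h2 : a ≤ Real.pi := Complex.arg_le_pi _
      have h0 : a ≠ 0 := by
        intro h0
        rw [h0, Circle.exp_zero] at hexp
        exact hw (by simpa using (congrArg (z * ·) hexp).symm)
      rcases lt_or_gt_of_ne h0 with h | h
      · refine ⟨a + 2 * Real.pi, ⟨by linarith, by linarith⟩, ?_⟩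
        rw [Circle.exp_add, Circle.exp_two_pi, mul_one, hexp, mul_inv_cancel_left]
      · exact ⟨a, ⟨h, by linarith⟩, by rw [hexp, mul_inv_cancel_left]⟩
    · rintro ⟨t, ht, rfl⟩ h
      have h1 : Circle.exp t = 1 := by simpa using h
      obtain ⟨n, hn⟩ := Circle.exp_eq_one.1 h1
      have h2 : (0 : ℝ) < n := by
        by_contra h3; push Not at h3; nlinarith [ht.1]
      have h3 : (n : ℝ) < 1 := by
        by_contra h3; push Not at h3; nlinarith [ht.2]
      have h4 : 0 < n := by exact_mod_cast h2
      have h5 : n < 1 := by exact_mod_cast h3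
      omega
  rw [h]
  exact isPreconnected_Ioo.image _ (by fun_prop)

/-- A regular level of a function with divisor `x + i x - y - i y` is one orbit. A simple closed
curve through the orbits of `x` and `y` would have to pass it twice. -/
theorem isTree_of_isPrincipal {M₀ : Model Γ} (hB : Bridgeless M₀.verts) {i : Γ ≃ᵢ Γ}
    (hi : IsInvolution i)
    (hpair : ∀ x y, IsPrincipal (pairDivisor x (i x) - pairDivisor y (i y))) :
    IsTree (OrbitSpace i) := by
  have hconn := M₀.connectedSpace
  refine ⟨?_, ?_⟩
  · exact Quot.mk_surjective.connectedSpace continuous_quot_mk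
  rintro ⟨c, hc, hinj⟩
  obtain ⟨P, Q, hPQ⟩ : ∃ P Q : Circle, P ≠ Q := by
    exact ⟨_, _, Circle.exp_pi_ne_one⟩
  obtain ⟨x, hx⟩ := Quot.exists_rep (c P)
  obtain ⟨y, hy⟩ := Quot.exists_rep (c Q)
  obtain ⟨f, M, s, hM, hf, hs, hD⟩ := (hpair x y).exists_linearizes M₀
  replace hB' := hB.mono hM
  have hxm := Model.le_of_pair hB' hf hs hD
  have hDx : pairDivisor (i x) x - pairDivisor y (i y) = M.divisor s := by
    rwa [pairDivisor_comm (i x) x]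
  have hxm' := Model.le_of_pair hB' hf hs hDx
  have hym := Model.le_of_pair' hB' hf hs hD
  have hlt : f x < f y := by
    by_contra h
    have hconst : ∀ a b, f a ≤ f b := fun a b => (hym a).trans ((not_lt.1 h).trans (hxm b))
    rw [Model.divisor_eq_zero hs hconst, sub_eq_zero] at hD
    classical
    have h1 := DFunLike.congr_fun hD x
    rw [pairDivisor_apply, pairDivisor_apply, if_pos rfl] at h1
    have h2 : y = x ∨ i y = x := by
      by_contra hne
      rw [not_or] at hne
      rw [if_neg hne.1, if_neg hne.2] at h1
      split_ifs at h1 <;> omega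
    refine hPQ (hinj ?_)
    rw [← hx, ← hy]
    rcases h2 with h2 | h2
    · rw [h2]
    · exact (Quot.sound (r := fun x y : Γ => i x = y) h2).symm
  obtain ⟨a, ha, hb, hreg⟩ := M.exists_regular f hlt
  obtain ⟨p, q, hlev, hpq⟩ := exists_level_pair hB' hf hs hD hreg ha hb
  -- `p + q ~ x + i x ~ p + i p`, and distinct points are not equivalent.
  have hq : q = i p := by
    refine eq_of_isPrincipal hB ?_
    have := hpq.sub (hpair x p)
    rw [sub_sub_sub_cancel_left] at this
    rw [pairDivisor, pairDivisor, add_sub_add_left_eq_sub] at this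
    exact this.sub_comm
  -- The maximum descends to the quotient without a proof that `f` is invariant.
  let g : OrbitSpace i → ℝ := Quot.lift (fun z => max (f z) (f (i z))) (by
    rintro z _ rfl
    simp only [hi z, max_comm])
  have hg : Continuous g := continuous_quot_lift _ (hf.max (hf.comp i.continuous))
  have hgp : ∀ w, g w = a → w = Quot.mk _ p := by
    rintro ⟨z⟩ hz
    have hz' : f z = a ∨ f (i z) = a := by
      have : max (f z) (f (i z)) = a := hz
      rcases max_choice (f z) (f (i z)) with h | h <;> rw [h] at this <;> simp [this]
    have hsw : ∀ w, w = p ∨ w = q → (Quot.mk _ w : OrbitSpace i) = Quot.mk _ p := by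
      rintro w (rfl | rfl)
      · rfl
      · rw [hq]; exact (Quot.sound (r := fun x y : Γ => i x = y) rfl).symm
    rcases hz' with h | h
    · exact hsw z (hlev z h)
    · rw [← hsw (i z) (hlev _ h)]; exact Quot.sound rfl
  have hgx : g (c P) < a := by
    rw [← hx]; exact max_lt ha ((hxm' x).trans_lt ha)
  have hgy : a < g (c Q) := by
    rw [← hy]; exact lt_max_of_lt_left hb
  have hconnC : IsPreconnected (univ : Set Circle) := by
    rw [← (show Function.Surjective Circle.exp from fun z => ⟨_, Circle.exp_arg z⟩).range_eq]
    exact isPreconnected_range Circle.exp.continuous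
  obtain ⟨z, -, hz⟩ := hconnC.intermediate_value (mem_univ P) (mem_univ Q)
    (hg.comp hc).continuousOn ⟨hgx.le, hgy.le⟩
  obtain ⟨z', hz', hz''⟩ := (isPreconnected_compl_singleton_circle z).intermediate_value
    (a := P) (b := Q) (by rintro rfl; exact hgx.ne hz) (by rintro rfl; exact hgy.ne' hz)
    (hg.comp hc).continuousOn ⟨hgx.le, hgy.le⟩
  exact hz' (hinj ((hgp _ hz'').trans (hgp _ hz).symm))

end MetricGraph

/-! ### Half-edges and arcs in the quotient. -/

namespace MetricGraph

open Set Filter Topology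

section Concat

variable {X : Type*}

/-- The path `ρ` on `[0, r]`, followed by `γ`. -/
noncomputable def concat (ρ γ : ℝ → X) (r : ℝ) (t : ℝ) : X := if t ≤ r then ρ t else γ (t - r)

theorem concat_of_le (ρ γ : ℝ → X) {r t : ℝ} (h : t ≤ r) : concat ρ γ r t = ρ t := if_pos h

theorem concat_of_ge {ρ γ : ℝ → X} {r t : ℝ} (h : r ≤ t) (h0 : ρ r = γ 0) :
    concat ρ γ r t = γ (t - r) := by
  rcases eq_or_lt_of_le h with rfl | h
  · rw [concat_of_le _ _ le_rfl, sub_self, h0]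
  · exact if_neg h.not_ge

theorem continuousOn_concat [TopologicalSpace X] {ρ γ : ℝ → X} {r L : ℝ} (hr : 0 ≤ r)
    (hL : 0 ≤ L) (hρ : ContinuousOn ρ (Icc 0 r)) (hγ : ContinuousOn γ (Icc 0 L))
    (h0 : ρ r = γ 0) : ContinuousOn (concat ρ γ r) (Icc 0 (r + L)) := by
  rw [← Icc_union_Icc_eq_Icc hr (by linarith : r ≤ r + L)]
  refine ContinuousOn.union_of_isClosed ?_ ?_ isClosed_Icc isClosed_Icc
  · exact hρ.congr fun t ht => concat_of_le _ _ ht.2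
  · refine (hγ.comp (f := fun t => t - r) (s := Icc r (r + L)) (by fun_prop) fun t ht => ?_).congr
      fun t ht => concat_of_ge ht.1 h0
    exact ⟨by linarith [ht.1], by linarith [ht.2]⟩

/-- `J` is `[0, L]` for arcs and `[0, L)` for closed curves, where the last point returns to the
first. -/
theorem injOn_concat {ρ γ : ℝ → X} {r : ℝ} {J : Set ℝ}
    (hρ : InjOn ρ (Icc 0 r)) (hγ : InjOn γ J)
    (hdisj : ∀ s ∈ Icc 0 r, ∀ t ∈ J, ρ s = γ t → t = 0) :
    InjOn (concat ρ γ r) {t | 0 ≤ t ∧ (t ≤ r ∨ t - r ∈ J)} := by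
  rintro s ⟨hs, hs'⟩ t ⟨ht, ht'⟩ h
  by_cases h1 : s ≤ r <;> by_cases h2 : t ≤ r
  · rw [concat_of_le _ _ h1, concat_of_le _ _ h2] at h
    exact hρ ⟨hs, h1⟩ ⟨ht, h2⟩ h
  · rw [concat_of_le _ _ h1, concat, if_neg h2] at h
    have := hdisj s ⟨hs, h1⟩ _ (ht'.resolve_left h2) h
    exact absurd (by linarith) h2
  · rw [concat_of_le _ _ h2, concat, if_neg h1] at h
    have := hdisj t ⟨ht, h2⟩ _ (hs'.resolve_left h1) h.symm
    exact absurd (by linarith) h1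
  · rw [concat, concat, if_neg h1, if_neg h2] at h
    have := hγ (hs'.resolve_left h1) (ht'.resolve_left h2) h
    linarith

theorem exists_circle_of_loop [TopologicalSpace X] {γ : ℝ → X} {L : ℝ} (hL : 0 < L)
    (hγ : ContinuousOn γ (Icc 0 L)) (hinj : InjOn γ (Ico 0 L)) (h0 : γ 0 = γ L) :
    ∃ c : Circle → X, Continuous c ∧ Function.Injective c := by
  have : Fact (0 < L) := ⟨hL⟩
  have hc : Continuous (AddCircle.liftIco L 0 γ) :=
    AddCircle.liftIco_continuous (by rwa [zero_add]) (by rwa [zero_add])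
  refine ⟨AddCircle.liftIco L 0 γ ∘ (AddCircle.homeomorphCircle hL.ne').symm,
    hc.comp (Homeomorph.continuous _), ?_⟩
  refine Function.Injective.comp ?_ (Homeomorph.injective _)
  refine Function.Injective.comp (injOn_iff_injective.1 ?_) (Equiv.injective _)
  rwa [zero_add]

end Concat

variable {Γ : Type*} [MetricSpace Γ]

theorem quot_mk_eq_iff {i : Γ ≃ᵢ Γ} (hi : IsInvolution i) {x y : Γ} :
    (Quot.mk _ x : OrbitSpace i) = Quot.mk _ y ↔ y = x ∨ y = i x := by
  constructor
  · intro h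
    have h1 := Quot.eqvGen_exact h
    clear h
    induction h1 with
    | rel x y h => exact Or.inr h.symm
    | refl x => exact Or.inl rfl
    | symm x y _ ih =>
      rcases ih with rfl | rfl
      · exact Or.inl rfl
      · exact Or.inr (hi x).symm
    | trans x y z _ _ ih1 ih2 =>
      rcases ih1 with rfl | rfl <;> rcases ih2 with rfl | rfl
      · exact Or.inl rfl
      · exact Or.inr rfl
      · exact Or.inr rfl
      · exact Or.inl (hi x)
  · rintro (rfl | rfl)
    · rfl
    · exact Quot.sound rfl

namespace Model

/-- The function is continuous if it is continuous on the edges. -/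
theorem continuous_of_edges (M : Model Γ) {X : Type*} [TopologicalSpace X] {f : Γ → X}
    (h : ∀ e, ContinuousOn (fun t => f (M.param e t)) (Icc 0 (M.len e))) : Continuous f := by
  rw [continuous_iff_isClosed]
  intro C hC
  have : f ⁻¹' C = (M.verts ∩ f ⁻¹' C) ∪
      ⋃ e, M.param e '' (Icc 0 (M.len e) ∩ (fun t => f (M.param e t)) ⁻¹' C) := by
    ext x
    simp only [mem_preimage, mem_union, mem_inter_iff, mem_iUnion, mem_image]
    constructor
    · intro hx
      rcases M.toPreModel.exists_param_eq x with h | ⟨e, t, ht, rfl⟩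
      · exact Or.inl ⟨h, hx⟩
      · exact Or.inr ⟨e, t, ⟨ht, hx⟩, rfl⟩
    · rintro (h | ⟨e, t, ⟨-, h⟩, rfl⟩)
      · exact h.2
      · exact h
  rw [this]
  refine (M.verts_finite.subset inter_subset_left).isClosed.union
    (isClosed_iUnion_of_finite fun e => ?_)
  refine IsCompact.isClosed (IsCompact.image_of_continuousOn ?_
    ((M.continuousOn_param e).mono inter_subset_left))
  exact isCompact_Icc.of_isClosed_subset ((h e).preimage_isClosed_of_isClosed isClosed_Icc hC)
    inter_subset_left

/-- Half of the edge `h.1`, starting from its first or its second end. -/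
noncomputable def half (M : Model Γ) (h : M.Edge × Bool) (t : ℝ) : Γ :=
  M.param h.1 (if h.2 then M.len h.1 - t else t)

/-- The length of a half-edge. -/
noncomputable def halfLen (M : Model Γ) (h : M.Edge × Bool) : ℝ := M.len h.1 / 2

theorem halfLen_pos (M : Model Γ) (h : M.Edge × Bool) : 0 < M.halfLen h := half_pos (M.len_pos _)

variable {M : Model Γ}

theorem half_mem_Icc {h : M.Edge × Bool} {t : ℝ} (ht : t ∈ Icc 0 (M.halfLen h)) :
    (if h.2 then M.len h.1 - t else t) ∈ Icc 0 (M.len h.1) := by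
  have h1 := ht.1
  have h2 := ht.2
  have h3 := M.len_pos h.1
  unfold halfLen at h2
  split_ifs <;> constructor <;> linarith

theorem half_mem_Ioo {h : M.Edge × Bool} {t : ℝ} (ht : t ∈ Ioc 0 (M.halfLen h)) :
    (if h.2 then M.len h.1 - t else t) ∈ Ioo 0 (M.len h.1) := by
  have h1 := ht.1
  have h2 := ht.2
  have h3 := M.len_pos h.1
  unfold halfLen at h2
  split_ifs <;> constructor <;> linarith

theorem continuousOn_half (h : M.Edge × Bool) : ContinuousOn (M.half h) (Icc 0 (M.halfLen h)) := by
  refine (M.continuousOn_param h.1).comp ?_ fun t ht => half_mem_Icc ht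
  split_ifs <;> fun_prop

theorem half_zero_mem (h : M.Edge × Bool) : M.half h 0 ∈ M.verts := by
  unfold half
  split_ifs
  · rw [sub_zero]; exact M.len_mem _
  · exact M.zero_mem _

theorem half_notMem {h : M.Edge × Bool} {t : ℝ} (ht : t ∈ Ioc 0 (M.halfLen h)) :
    M.half h t ∉ M.verts :=
  M.interior_notMem _ _ (half_mem_Ioo ht)

/-- One parameter must stay below `halfLen`, since the two halves of an edge share its midpoint. -/
theorem half_inj {h h' : M.Edge × Bool} {s t : ℝ} (hs : s ∈ Ioo 0 (M.halfLen h))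
    (ht : t ∈ Ioc 0 (M.halfLen h')) (heq : M.half h s = M.half h' t) : h = h' ∧ s = t := by
  obtain ⟨e, b⟩ := h
  obtain ⟨e', b'⟩ := h'
  obtain ⟨h1, h2⟩ := M.interior_inj _ _ _ (half_mem_Ioo (Ioo_subset_Ioc_self hs)) _
    (half_mem_Ioo ht) heq
  simp only at h1
  subst h1
  simp only [halfLen, mem_Ioo, mem_Ioc] at hs ht h2
  cases b <;> cases b' <;> simp at h2
  · exact ⟨rfl, h2⟩
  · linarith
  · linarith
  · exact ⟨rfl, h2⟩

theorem half_injOn (h : M.Edge × Bool) : InjOn (M.half h) (Icc 0 (M.halfLen h)) := by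
  intro s hs t ht hst
  have aux : ∀ {u}, u ∈ Icc 0 (M.halfLen h) → u ≠ 0 → u ∈ Ioc 0 (M.halfLen h) := fun hu h0 =>
    ⟨lt_of_le_of_ne hu.1 (Ne.symm h0), hu.2⟩
  by_cases hs0 : s = 0
  · by_contra hne
    refine half_notMem (aux ht (by rintro rfl; exact hne hs0)) ?_
    rw [← hst, hs0]
    exact half_zero_mem h
  by_cases ht0 : t = 0
  · exact absurd (by rw [hst, ht0]; exact half_zero_mem h) (half_notMem (aux hs hs0))
  rcases eq_or_lt_of_le hs.2 with h1 | h1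
  · rcases eq_or_lt_of_le ht.2 with h2 | h2
    · rw [h1, h2]
    · exact (half_inj ⟨(aux ht ht0).1, h2⟩ (aux hs hs0) hst.symm).2.symm
  · exact (half_inj ⟨(aux hs hs0).1, h1⟩ (aux ht ht0) hst).2

theorem exists_half_eq (M : Model Γ) (x : Γ) :
    x ∈ M.verts ∨ ∃ h, ∃ t ∈ Ioc 0 (M.halfLen h), M.half h t = x := by
  refine (M.cover x).imp_right ?_
  rintro ⟨e, t, ht, rfl⟩
  rcases le_total t (M.len e / 2) with h | h
  · exact ⟨(e, false), t, ⟨ht.1, h⟩, by simp [half]⟩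
  · refine ⟨(e, true), M.len e - t, ⟨by linarith [ht.2], ?_⟩, by simp [half]⟩
    simp only [halfLen]; linarith

/-- The involution `i` maps half-edges to half-edges. -/
def PermutesHalves (M : Model Γ) (i : Γ ≃ᵢ Γ) (σ : M.Edge × Bool → M.Edge × Bool) : Prop :=
  ∀ h, M.halfLen (σ h) = M.halfLen h ∧ ∀ t ∈ Icc 0 (M.halfLen h), i (M.half h t) = M.half (σ h) t

variable {i : Γ ≃ᵢ Γ} {σ : M.Edge × Bool → M.Edge × Bool}

theorem PermutesHalves.involutive (hσ : M.PermutesHalves i σ) (hi : IsInvolution i)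
    (h : M.Edge × Bool) : σ (σ h) = h := by
  have hpos := M.halfLen_pos h
  have hm : M.halfLen h / 2 ∈ Icc 0 (M.halfLen h) := ⟨by linarith, by linarith⟩
  have h1 := (hσ h).2 _ hm
  have h2 := (hσ (σ h)).2 (M.halfLen h / 2) ((hσ h).1.symm ▸ hm)
  rw [← h1, hi] at h2
  refine (half_inj (s := M.halfLen h / 2) (t := M.halfLen h / 2) ⟨by linarith, by linarith⟩
    ⟨by linarith, ?_⟩ h2).1.symm
  rw [(hσ (σ h)).1, (hσ h).1]
  linarith

/-- The orbits of interior points of half-edges. -/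
theorem quot_half_eq (hσ : M.PermutesHalves i σ) (hi : IsInvolution i) {h h' : M.Edge × Bool}
    {s t : ℝ} (hs : s ∈ Ioo 0 (M.halfLen h)) (ht : t ∈ Icc 0 (M.halfLen h'))
    (heq : (Quot.mk _ (M.half h s) : OrbitSpace i) = Quot.mk _ (M.half h' t)) :
    (h' = h ∨ h' = σ h) ∧ t = s := by
  have ht0 : t ≠ 0 := by
    rintro rfl
    rcases (quot_mk_eq_iff hi).1 heq with h1 | h1
    · exact half_notMem (Ioo_subset_Ioc_self hs) (h1 ▸ half_zero_mem h')
    · rw [(hσ h).2 s (Ioo_subset_Icc_self hs)] at h1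
      refine half_notMem (h := σ h) (t := s) ?_ (h1 ▸ half_zero_mem h')
      rw [(hσ h).1]; exact Ioo_subset_Ioc_self hs
  have ht' : t ∈ Ioc 0 (M.halfLen h') := ⟨lt_of_le_of_ne ht.1 (Ne.symm ht0), ht.2⟩
  rcases (quot_mk_eq_iff hi).1 heq with h1 | h1
  · obtain ⟨h2, h3⟩ := half_inj hs ht' h1.symm
    exact ⟨Or.inl h2.symm, h3.symm⟩
  · rw [(hσ h).2 s (Ioo_subset_Icc_self hs)] at h1
    obtain ⟨h2, h3⟩ := half_inj ((hσ h).1.symm ▸ hs) ht' h1.symm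
    exact ⟨Or.inr h2.symm, h3.symm⟩

/-- Half-edges are used for this reason: an involution that reverses an edge folds it in the
quotient, but each half still embeds. -/
theorem quot_half_injOn (hσ : M.PermutesHalves i σ) (hi : IsInvolution i) (h : M.Edge × Bool) :
    InjOn (fun t => (Quot.mk _ (M.half h t) : OrbitSpace i)) (Icc 0 (M.halfLen h)) := by
  have aux : ∀ s ∈ Icc 0 (M.halfLen h), ∀ t ∈ Icc 0 (M.halfLen h), s < t →
      (Quot.mk _ (M.half h s) : OrbitSpace i) = Quot.mk _ (M.half h t) → s = t := by
    intro s hs t ht hlt hst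
    rcases eq_or_lt_of_le hs.1 with h0 | h0
    · rcases eq_or_lt_of_le ht.2 with h1 | h1
      · rcases (quot_mk_eq_iff hi).1 hst with h2 | h2
        · exact (half_injOn h ht hs h2).symm
        · rw [(hσ h).2 s hs, ← h0] at h2
          exact absurd (h2 ▸ half_zero_mem _) (half_notMem ⟨by linarith, ht.2⟩)
      · exact (quot_half_eq hσ hi ⟨by linarith, h1⟩ hs hst.symm).2
    · exact (quot_half_eq hσ hi ⟨h0, hlt.trans_le ht.2⟩ ht hst).2.symm
  intro s hs t ht hst
  rcases lt_trichotomy s t with h1 | h1 | h1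
  · exact aux s hs t ht h1 hst
  · exact h1
  · exact (aux t ht s hs h1 hst.symm).symm

/-- The graph of the half-edges in the quotient, without the edge that is the image of `h₀`. -/
def quotGraph (M : Model Γ) (i : Γ ≃ᵢ Γ) (σ : M.Edge × Bool → M.Edge × Bool)
    (h₀ : M.Edge × Bool) : SimpleGraph (OrbitSpace i) where
  Adj a b := a ≠ b ∧ ∃ h, h ≠ h₀ ∧ h ≠ σ h₀ ∧
    ((Quot.mk _ (M.half h 0) = a ∧ Quot.mk _ (M.half h (M.halfLen h)) = b) ∨
      (Quot.mk _ (M.half h 0) = b ∧ Quot.mk _ (M.half h (M.halfLen h)) = a))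
  symm := ⟨fun _ _ ⟨hab, h, h1, h2, h3⟩ => ⟨hab.symm, h, h1, h2, h3.symm⟩⟩
  loopless := ⟨fun _ h => h.1 rfl⟩

/-- The half-edges along a combinatorial path are concatenated to an embedded arc. The last clause
locates each point of the arc, at a node or inside a half-edge with both ends on the path; the
induction and the closing of the arc by `h₀` need this for injectivity. -/
theorem exists_arc (hσ : M.PermutesHalves i σ) (hi : IsInvolution i) (h₀ : M.Edge × Bool)
    {a b : OrbitSpace i} (p : (M.quotGraph i σ h₀).Walk a b) (hp : p.IsPath) :
    (∀ h, ∀ s ∈ Ioo 0 (M.halfLen h), Quot.mk _ (M.half h s) ≠ b) →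
    ∃ L ≥ 0, ∃ γ : ℝ → OrbitSpace i, ContinuousOn γ (Icc 0 L) ∧ InjOn γ (Icc 0 L) ∧ γ 0 = a ∧
      γ L = b ∧ ∀ t ∈ Icc 0 L,
        (γ t ∈ p.support ∧ ∀ h, ∀ s ∈ Ioo 0 (M.halfLen h), Quot.mk _ (M.half h s) ≠ γ t) ∨
        ∃ h, h ≠ h₀ ∧ h ≠ σ h₀ ∧ ∃ s ∈ Ioo 0 (M.halfLen h), Quot.mk _ (M.half h s) = γ t ∧
          Quot.mk _ (M.half h 0) ∈ p.support ∧
          Quot.mk _ (M.half h (M.halfLen h)) ∈ p.support := by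
  induction p with
  | @nil a =>
    intro hb
    refine ⟨0, le_rfl, fun _ => a, continuousOn_const, by simp, rfl, rfl, fun t _ => Or.inl ?_⟩
    exact ⟨by simp, hb⟩
  | @cons a w b hadj p ih =>
    intro hb
    rw [SimpleGraph.Walk.cons_isPath_iff] at hp
    obtain ⟨L, hL, γ, hγc, hγi, hγ0, hγL, hγ⟩ := ih hp.1 hb
    have hmem : ∀ x, x = a ∨ x ∈ p.support → x ∈ (SimpleGraph.Walk.cons hadj p).support := by
      intro x hx
      rwa [SimpleGraph.Walk.support_cons, List.mem_cons]
    have hadj' := hadj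
    obtain ⟨hne, h, hh1, hh2, hends⟩ := hadj'
    have hr := M.halfLen_pos h
    have hnode0 : ∀ h', ∀ s ∈ Ioo 0 (M.halfLen h'),
        (Quot.mk _ (M.half h' s) : OrbitSpace i) ≠ Quot.mk _ (M.half h 0) := fun h' s hs heq =>
      hs.1.ne (quot_half_eq hσ hi hs ⟨le_rfl, hr.le⟩ heq).2
    have hnode1 : ∀ h', ∀ s ∈ Ioo 0 (M.halfLen h'),
        (Quot.mk _ (M.half h' s) : OrbitSpace i) ≠ Quot.mk _ (M.half h (M.halfLen h)) := by
      intro h' s hs heq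
      obtain ⟨h1, h2⟩ := quot_half_eq hσ hi hs ⟨hr.le, le_rfl⟩ heq
      have : M.halfLen h = M.halfLen h' := by
        rcases h1 with rfl | rfl
        · rfl
        · exact (hσ h').1
      linarith [hs.2]
    have hnodea : ∀ h', ∀ s ∈ Ioo 0 (M.halfLen h'),
        (Quot.mk _ (M.half h' s) : OrbitSpace i) ≠ a := by
      rcases hends with ⟨rfl, -⟩ | ⟨-, rfl⟩
      exacts [hnode0, hnode1]
    obtain ⟨ρ, hρc, hρi, hρ0, hρr, hρ⟩ : ∃ ρ : ℝ → OrbitSpace i,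
        ContinuousOn ρ (Icc 0 (M.halfLen h)) ∧ InjOn ρ (Icc 0 (M.halfLen h)) ∧ ρ 0 = a ∧
        ρ (M.halfLen h) = w ∧
        ∀ t ∈ Ioo 0 (M.halfLen h), ∃ s ∈ Ioo 0 (M.halfLen h), Quot.mk _ (M.half h s) = ρ t := by
      have hc : ContinuousOn (fun t => (Quot.mk _ (M.half h t) : OrbitSpace i))
          (Icc 0 (M.halfLen h)) := continuous_quot_mk.comp_continuousOn (continuousOn_half h)
      rcases hends with ⟨h1, h2⟩ | ⟨h1, h2⟩
      · exact ⟨fun t => Quot.mk _ (M.half h t), hc, quot_half_injOn hσ hi h, h1, h2,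
          fun t ht => ⟨t, ht, rfl⟩⟩
      · have hmaps : MapsTo (fun t => M.halfLen h - t) (Icc 0 (M.halfLen h))
            (Icc 0 (M.halfLen h)) := fun t ht => ⟨by linarith [ht.2], by linarith [ht.1]⟩
        refine ⟨fun t => Quot.mk _ (M.half h (M.halfLen h - t)), hc.comp (by fun_prop) hmaps,
          fun s hs t ht hst => ?_, by simpa using h2, by simpa using h1,
          fun t ht => ⟨M.halfLen h - t, ⟨by linarith [ht.2], by linarith [ht.1]⟩, rfl⟩⟩
        have := quot_half_injOn hσ hi h (hmaps hs) (hmaps ht) hst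
        simpa using this
    have hends' : (Quot.mk _ (M.half h 0) = a ∨ Quot.mk _ (M.half h 0) = w) ∧
        (Quot.mk _ (M.half h (M.halfLen h)) = a ∨ Quot.mk _ (M.half h (M.halfLen h)) = w) := by
      rcases hends with ⟨h1, h2⟩ | ⟨h1, h2⟩
      · exact ⟨Or.inl h1, Or.inr h2⟩
      · exact ⟨Or.inr h1, Or.inl h2⟩
    have hj : ρ (M.halfLen h) = γ 0 := by rw [hρr, hγ0]
    refine ⟨M.halfLen h + L, by linarith, concat ρ γ (M.halfLen h),
      continuousOn_concat hr.le hL hρc hγc hj,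
      (injOn_concat (J := Icc 0 L) hρi hγi ?_).mono ?_, ?_, ?_, ?_⟩
    · intro s hs t ht hst
      rcases eq_or_lt_of_le hs.1 with h0 | h0
      · exfalso
        rw [← h0, hρ0] at hst
        rcases hγ t ht with ⟨h1, -⟩ | ⟨h', -, -, s', hs', h1, -⟩
        · exact hp.2 (hst ▸ h1)
        · exact hnodea h' s' hs' (h1.trans hst.symm)
      rcases eq_or_lt_of_le hs.2 with h1 | h1
      · rw [h1, hj] at hst
        exact (hγi ⟨le_rfl, hL⟩ ht hst).symm
      · exfalso
        obtain ⟨u, hu, hu'⟩ := hρ s ⟨h0, h1⟩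
        rcases hγ t ht with ⟨-, h2⟩ | ⟨h', -, -, s', hs', h2, h3, h4⟩
        · exact h2 h u hu (hu'.trans hst)
        -- If the rest of the arc met the interior of the first half-edge, it would contain the same
        -- half-edge up to `σ`, and `a` would lie on the remaining path.
        · have h5 := (quot_half_eq hσ hi hu (Ioo_subset_Icc_self hs')
            (hu'.trans (hst.trans h2.symm))).1
          have h6 : (Quot.mk _ (M.half h' 0) : OrbitSpace i) = Quot.mk _ (M.half h 0) ∧
              (Quot.mk _ (M.half h' (M.halfLen h')) : OrbitSpace i) =
                Quot.mk _ (M.half h (M.halfLen h)) := by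
            rcases h5 with rfl | rfl
            · exact ⟨rfl, rfl⟩
            · rw [(hσ h).1, ← (hσ h).2 _ ⟨le_rfl, hr.le⟩, ← (hσ h).2 _ ⟨hr.le, le_rfl⟩]
              exact ⟨((quot_mk_eq_iff hi).2 (Or.inr rfl)).symm,
                ((quot_mk_eq_iff hi).2 (Or.inr rfl)).symm⟩
          rw [h6.1] at h3
          rw [h6.2] at h4
          rcases hends with ⟨h7, -⟩ | ⟨-, h7⟩
          · exact hp.2 (h7 ▸ h3)
          · exact hp.2 (h7 ▸ h4)
    · intro t ht
      refine ⟨ht.1, ?_⟩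
      rcases le_total t (M.halfLen h) with h1 | h1
      · exact Or.inl h1
      · exact Or.inr ⟨by linarith, by linarith [ht.2]⟩
    · rw [concat_of_le _ _ hr.le, hρ0]
    · rw [concat_of_ge (by linarith) hj, add_sub_cancel_left, hγL]
    · intro t ht
      rcases le_total t (M.halfLen h) with h1 | h1
      · rw [concat_of_le _ _ h1]
        rcases eq_or_lt_of_le ht.1 with h0 | h0
        · left
          rw [← h0, hρ0]
          exact ⟨hmem _ (Or.inl rfl), hnodea⟩
        rcases eq_or_lt_of_le h1 with h2 | h2
        · left
          rw [h2, hρr]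
          refine ⟨hmem _ (Or.inr p.start_mem_support), ?_⟩
          rcases hends with ⟨-, rfl⟩ | ⟨rfl, -⟩
          exacts [hnode1, hnode0]
        · right
          obtain ⟨u, hu, hu'⟩ := hρ t ⟨h0, h2⟩
          refine ⟨h, hh1, hh2, u, hu, hu', ?_, ?_⟩
          · rcases hends'.1 with k | k
            · exact hmem _ (Or.inl k)
            · exact hmem _ (Or.inr (by rw [k]; exact p.start_mem_support))
          · rcases hends'.2 with k | k
            · exact hmem _ (Or.inl k)
            · exact hmem _ (Or.inr (by rw [k]; exact p.start_mem_support))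
      · rw [concat_of_ge h1 hj]
        rcases hγ (t - M.halfLen h) ⟨by linarith, by linarith [ht.2]⟩ with
          ⟨h2, h3⟩ | ⟨h', k1, k2, s', hs', k3, k4, k5⟩
        · exact Or.inl ⟨hmem _ (Or.inr h2), h3⟩
        · exact Or.inr ⟨h', k1, k2, s', hs', k3, hmem _ (Or.inr k4), hmem _ (Or.inr k5)⟩

/-- In a quotient that is a tree, the ends of a half-edge are separated by its interior. -/
theorem not_reachable_of_isTree (hσ : M.PermutesHalves i σ) (hi : IsInvolution i)
    (hT : IsTree (OrbitSpace i)) (h₀ : M.Edge × Bool) :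
    ¬ (M.quotGraph i σ h₀).Reachable (Quot.mk _ (M.half h₀ 0))
      (Quot.mk _ (M.half h₀ (M.halfLen h₀))) := by
  classical
  rintro ⟨p⟩
  have hr := M.halfLen_pos h₀
  obtain ⟨L, hL, γ, hγc, hγi, hγ0, hγL, hγ⟩ := exists_arc hσ hi h₀ p.bypass p.bypass_isPath (by
    intro h' s hs heq
    obtain ⟨h1, h2⟩ := quot_half_eq hσ hi hs ⟨hr.le, le_rfl⟩ heq
    have : M.halfLen h₀ = M.halfLen h' := by
      rcases h1 with rfl | rfl
      · rfl
      · exact (hσ h').1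
    linarith [hs.2])
  have hmaps : MapsTo (fun t => M.halfLen h₀ - t) (Icc 0 (M.halfLen h₀))
      (Icc 0 (M.halfLen h₀)) := fun t ht => ⟨by linarith [ht.2], by linarith [ht.1]⟩
  -- The image of `h₀` run backwards, followed by the arc `γ` from its start to its far end, is a
  -- simple closed curve.
  let ρ : ℝ → OrbitSpace i := fun t => Quot.mk _ (M.half h₀ (M.halfLen h₀ - t))
  have hρc : ContinuousOn ρ (Icc 0 (M.halfLen h₀)) :=
    (continuous_quot_mk.comp_continuousOn (continuousOn_half h₀)).comp (by fun_prop) hmaps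
  have hρi : InjOn ρ (Icc 0 (M.halfLen h₀)) := fun s hs t ht hst => by
    simpa using quot_half_injOn hσ hi h₀ (hmaps hs) (hmaps ht) hst
  have hj : ρ (M.halfLen h₀) = γ 0 := by simp [ρ, hγ0]
  refine hT.2 (exists_circle_of_loop (γ := concat ρ γ (M.halfLen h₀))
    (L := M.halfLen h₀ + L) (by linarith) (continuousOn_concat hr.le hL hρc hγc hj)
    ((injOn_concat (J := Ico 0 L) hρi (hγi.mono Ico_subset_Icc_self) ?_).mono
      ?_) ?_)
  · intro s hs t ht hst
    rcases eq_or_lt_of_le hs.1 with h0 | h0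
    · exfalso
      rw [← h0] at hst
      have : γ t = γ L := by rw [← hst, hγL]; simp [ρ]
      exact ht.2.ne (hγi (Ico_subset_Icc_self ht) ⟨hL, le_rfl⟩ this)
    rcases eq_or_lt_of_le hs.2 with h1 | h1
    · rw [h1, hj] at hst
      exact (hγi ⟨le_rfl, hL⟩ (Ico_subset_Icc_self ht) hst).symm
    · exfalso
      have hu : M.halfLen h₀ - s ∈ Ioo 0 (M.halfLen h₀) := ⟨by linarith, by linarith⟩
      rcases hγ t (Ico_subset_Icc_self ht) with ⟨-, h2⟩ | ⟨h', k1, k2, s', hs', k3, -⟩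
      · exact h2 h₀ _ hu hst
      · rcases (quot_half_eq hσ hi hu (Ioo_subset_Icc_self hs') (hst.trans k3.symm)).1 with h | h
        exacts [k1 h, k2 h]
  · intro t ht
    refine ⟨ht.1, ?_⟩
    rcases le_total t (M.halfLen h₀) with h1 | h1
    · exact Or.inl h1
    · exact Or.inr ⟨by linarith, by linarith [ht.2]⟩
  · rw [concat_of_le _ _ hr.le, concat_of_ge (by linarith) hj, add_sub_cancel_left, hγL]
    simp [ρ]

end Model

end MetricGraph

/-! ### Isometries and half-edges; cut functions. -/

namespace MetricGraph

open Set Filter Topology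

variable {Γ : Type*} [MetricSpace Γ]

namespace Model

/-- The image of a model under an isometry, without the metric. -/
def mapPre (M : Model Γ) (i : Γ ≃ᵢ Γ) : PreModel Γ where
  verts := i '' M.verts
  verts_finite := M.verts_finite.image i
  verts_nonempty := M.verts_nonempty.image i
  Edge := M.Edge
  len := M.len
  len_pos := M.len_pos
  param e t := i (M.param e t)
  zero_mem e := ⟨_, M.zero_mem e, rfl⟩
  len_mem e := ⟨_, M.len_mem e, rfl⟩
  interior_notMem e t ht h := by
    rw [i.injective.mem_set_image] at h
    exact M.interior_notMem e t ht h
  interior_inj e e' s hs t ht h := M.interior_inj e e' s hs t ht (i.injective h)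
  cover x := by
    obtain ⟨y, rfl⟩ := i.surjective x
    rcases M.cover y with h | ⟨e, t, ht, rfl⟩
    · exact Or.inl ⟨y, h, rfl⟩
    · exact Or.inr ⟨e, t, ht, rfl⟩

theorem mapPre_pathOfLength_iff (M : Model Γ) (i : Γ ≃ᵢ Γ) (x y : Γ) (L : ℝ) :
    (M.mapPre i).PathOfLength (i x) (i y) L ↔ M.PathOfLength x y L := by
  constructor
  · intro h
    generalize hx : i x = x' at h
    generalize hy : i y = y' at h
    induction h generalizing x with
    | refl x' =>
      obtain rfl := i.injective (hx.trans hy.symm)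
      exact .refl x
    | step e s t hs ht y' L _ ih =>
      obtain rfl := i.injective hx
      exact PreModel.PathOfLength.step (M := M.toPreModel) e s t hs ht y L
        (ih (M.param e t) rfl hy)
  · intro h
    induction h with
    | refl x => exact .refl _
    | step e s t hs ht y L _ ih =>
      exact PreModel.PathOfLength.step (M := M.mapPre i) e s t hs ht (i y) L ih

/-- The image of a model under an isometry. -/
def map (M : Model Γ) (i : Γ ≃ᵢ Γ) : Model Γ where
  toPreModel := M.mapPre i
  dist_isLeast x y := by
    obtain ⟨x, rfl⟩ := i.surjective x
    obtain ⟨y, rfl⟩ := i.surjective y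
    simp only [mapPre_pathOfLength_iff, i.dist_eq]
    exact M.dist_isLeast x y

/-- Every vertex is the first end of at least three half-edges. -/
theorem exists_three_halves (M : Model Γ) (hcan : M.IsCanonical) (hM : M.IsEdgeConnected 2)
    [Nonempty M.Edge] {v : Γ} (hv : v ∈ M.verts) :
    ∃ h₁ h₂ h₃, M.half h₁ 0 = v ∧ M.half h₂ 0 = v ∧ M.half h₃ 0 = v ∧ h₁ ≠ h₂ ∧ h₁ ≠ h₃ ∧
      h₂ ≠ h₃ := by
  have hval : {h | M.half h 0 = v}.ncard = M.valence v := by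
    have : {h | M.half h 0 = v} = (fun e => (e, false)) '' {e | M.src e = v} ∪
        (fun e => (e, true)) '' {e | M.tgt e = v} := by
      ext ⟨e, b⟩
      cases b <;> simp [half, Model.src, Model.tgt]
    rw [this, ncard_union_eq, ncard_image_of_injective, ncard_image_of_injective]
    · rfl
    · intro e e' h; exact congrArg Prod.fst h
    · intro e e' h; exact congrArg Prod.fst h
    · rw [disjoint_left]
      rintro _ ⟨e, -, rfl⟩ ⟨e', -, h⟩
      exact absurd (congrArg Prod.snd h) (by simp)
  have hne : {h | M.half h 0 = v}.ncard ≠ 2 := hval ▸ hcan v hv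
  -- If at most `h₀` starts at `v`, removing the edge of `h₀` isolates `v`, so `v` is the only
  -- vertex. But then both halves of that edge start at `v`.
  have hle : ¬ {h | M.half h 0 = v}.ncard ≤ 1 := by
    intro hle
    rw [ncard_le_one_iff_subset_singleton] at hle
    obtain ⟨h₀, hh₀⟩ := hle
    have hall : ∀ w ∈ M.verts, v = w := by
      intro w hw
      rcases (hM {h₀.1} (by simp) v hv w hw).cases_head with h | ⟨u, ⟨e, he, h⟩, -⟩
      · exact h
      · exfalso
        rcases h with ⟨h, -⟩ | ⟨-, h⟩
        · have : (e, false) = h₀ := hh₀ (show M.half (e, false) 0 = v by simpa [half, Model.src, Model.tgt] using h)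
          exact he (by rw [← this]; rfl)
        · have : (e, true) = h₀ := hh₀ (show M.half (e, true) 0 = v by simpa [half, Model.src, Model.tgt] using h)
          exact he (by rw [← this]; rfl)
    have h1 : (h₀.1, false) = h₀ := hh₀ (hall _ (half_zero_mem _)).symm
    have h2 : (h₀.1, true) = h₀ := hh₀ (hall _ (half_zero_mem _)).symm
    exact absurd (congrArg Prod.snd (h1.trans h2.symm)) (by simp)
  obtain ⟨a, b, c, ha, hb, hc, h⟩ := (two_lt_ncard_iff (toFinite _)).1
    (show 2 < {h | M.half h 0 = v}.ncard by omega)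
  exact ⟨a, b, c, ha, hb, hc, h⟩

/-- At a small distance `r` from a vertex there are three distinct points, one on each of three
half-edges; near an interior point of an edge there are only two. -/
theorem map_mem_verts (M : Model Γ) (hcan : M.IsCanonical) (hM : M.IsEdgeConnected 2)
    [Nonempty M.Edge] (i : Γ ≃ᵢ Γ) {v : Γ} (hv : v ∈ M.verts) : i v ∈ M.verts := by
  by_contra hiv
  obtain ⟨e, t, ht, het⟩ := (M.cover (i v)).resolve_left hiv
  obtain ⟨h₁, h₂, h₃, e₁, e₂, e₃, h12, h13, h23⟩ := M.exists_three_halves hcan hM hv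
  obtain ⟨δ, hδ, hδe, hsrc, htgt, -⟩ := M.exists_star
  set r := min δ (min t (M.len e - t)) / 2 with hr
  have hm : 0 < min δ (min t (M.len e - t)) := lt_min hδ (lt_min ht.1 (by linarith [ht.2]))
  have hr0 : 0 < r := half_pos hm
  have hrδ : r < δ := by linarith [min_le_left δ (min t (M.len e - t))]
  have hlt : r < min t (M.len e - t) := by linarith [min_le_right δ (min t (M.len e - t))]
  have key : ∀ h, M.half h 0 = v → i (M.half h r) = M.param e (t + r) ∨
      i (M.half h r) = M.param e (t - r) := by
    intro h hh
    have hd : dist v (M.half h r) = r := by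
      rw [← hh]
      obtain ⟨e', b⟩ := h
      cases b
      · exact hsrc e' r ⟨hr0.le, hrδ.le⟩
      · have := htgt e' r ⟨hr0.le, hrδ.le⟩
        simpa [half, Model.tgt] using this
    rw [← i.dist_eq, ← het] at hd
    obtain ⟨s, -, h1, h2⟩ := M.exists_param_of_dist_lt e (min_le_left _ _) (min_le_right _ _)
      (hd.trans_lt hlt)
    rw [hd] at h2
    rcases (abs_eq hr0.le).1 h2 with h3 | h3
    · left; rw [← h1]; congr 1; linarith
    · right; rw [← h1]; congr 1; linarith
  have hinj : ∀ h h', M.half h r = M.half h' r → h = h' := by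
    intro h h' heq
    exact (half_inj ⟨hr0, hrδ.trans_le (hδe h.1)⟩ ⟨hr0, (hrδ.trans_le (hδe h'.1)).le⟩ heq).1
  rcases key h₁ e₁ with k1 | k1 <;> rcases key h₂ e₂ with k2 | k2 <;>
    rcases key h₃ e₃ with k3 | k3
  all_goals first
    | exact h12 (hinj _ _ (i.injective (k1.trans k2.symm)))
    | exact h13 (hinj _ _ (i.injective (k1.trans k3.symm)))
    | exact h23 (hinj _ _ (i.injective (k2.trans k3.symm)))

/-- The image of `M` under `i` is a model with the same vertices, hence with the same edges up to
orientation. -/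
theorem exists_permutesHalves (M : Model Γ) (hcan : M.IsCanonical) (hM : M.IsEdgeConnected 2)
    [Nonempty M.Edge] {i : Γ ≃ᵢ Γ} (hi : IsInvolution i) : ∃ σ, M.PermutesHalves i σ := by
  have hv : (M.map i).verts = M.verts := by
    refine Subset.antisymm ?_ fun v hv => ⟨i v, M.map_mem_verts hcan hM i hv, hi v⟩
    rintro _ ⟨v, hv, rfl⟩
    exact M.map_mem_verts hcan hM i hv
  have key : ∀ h : M.Edge × Bool, ∃ h', M.halfLen h' = M.halfLen h ∧
      ∀ t ∈ Icc 0 (M.halfLen h), i (M.half h t) = M.half h' t := by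
    intro h
    obtain ⟨e', hl, he'⟩ := (M.map i).exists_edge_eq M hv h.1
    replace hl : M.len h.1 = M.len e' := hl
    rcases he' with he' | he'
    · replace he' : ∀ t ∈ Icc 0 (M.len h.1), i (M.param h.1 t) = M.param e' t := he'
      refine ⟨(e', h.2), by simp only [halfLen, hl], fun t ht => ?_⟩
      rw [half, he' _ (half_mem_Icc ht), half, hl]
    · replace he' : ∀ t ∈ Icc 0 (M.len h.1),
          i (M.param h.1 t) = M.param e' (M.len h.1 - t) := he'
      refine ⟨(e', !h.2), by simp only [halfLen, hl], fun t ht => ?_⟩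
      rw [half, he' _ (half_mem_Icc ht), half]
      congr 1
      cases h.2 <;> simp [hl]
  choose σ hσ using key
  exact ⟨σ, hσ⟩

/-- A function that increases from `0` along the half-edge `h₀` and its image under `i`, and
is locally constant elsewhere. -/
structure IsCutFunction (M : Model Γ) (i : Γ ≃ᵢ Γ) (h₀ : M.Edge × Bool) (f : Γ → ℝ) : Prop where
  continuous : Continuous f
  nonneg : ∀ z, 0 ≤ f z
  half_eq : ∀ t ∈ Icc 0 (M.halfLen h₀), f (M.half h₀ t) = t
  map_half_eq : ∀ t ∈ Icc 0 (M.halfLen h₀), f (i (M.half h₀ t)) = t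
  eq_half : ∀ z, f z ∈ Ioo 0 (M.halfLen h₀) →
    z = M.half h₀ (f z) ∨ z = i (M.half h₀ (f z))

variable {M : Model Γ} {i j : Γ ≃ᵢ Γ} {σ τ : M.Edge × Bool → M.Edge × Bool}

/-- Take `0` on the component of the start of `h₀` in the quotient graph without the image of `h₀`,
and `halfLen h₀` on the others. The value changes only along `h₀` and `σ h₀`, and it does change
there because the ends of `h₀` are separated. -/
theorem exists_isCutFunction (hσ : M.PermutesHalves i σ) (hi : IsInvolution i)
    (hT : IsTree (OrbitSpace i)) (h₀ : M.Edge × Bool) : ∃ f, M.IsCutFunction i h₀ f := by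
  classical
  have hr := M.halfLen_pos h₀
  let ν : Γ → ℝ := fun z => if (M.quotGraph i σ h₀).Reachable (Quot.mk _ (M.half h₀ 0))
    (Quot.mk _ z) then 0 else M.halfLen h₀
  have hν : ∀ z, ν z = 0 ∨ ν z = M.halfLen h₀ := by
    intro z; simp only [ν]; split_ifs <;> simp
  have hν0 : ν (M.half h₀ 0) = 0 := if_pos (SimpleGraph.Reachable.refl _)
  have hνr : ν (M.half h₀ (M.halfLen h₀)) = M.halfLen h₀ :=
    if_neg (not_reachable_of_isTree hσ hi hT h₀)
  have hνi : ∀ z, ν (i z) = ν z := by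
    intro z
    have : (Quot.mk _ (i z) : OrbitSpace i) = Quot.mk _ z :=
      ((quot_mk_eq_iff hi).2 (Or.inr rfl)).symm
    simp only [ν, this]
  have hνh : ∀ h, h ≠ h₀ → h ≠ σ h₀ → ν (M.half h (M.halfLen h)) = ν (M.half h 0) := by
    intro h h1 h2
    have : (M.quotGraph i σ h₀).Reachable (Quot.mk _ (M.half h 0))
        (Quot.mk _ (M.half h (M.halfLen h))) := by
      by_cases heq : (Quot.mk _ (M.half h 0) : OrbitSpace i) = Quot.mk _ (M.half h (M.halfLen h))
      · rw [heq]
      · exact SimpleGraph.Adj.reachable ⟨heq, h, h1, h2, Or.inl ⟨rfl, rfl⟩⟩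
    simp only [ν]
    congr 1
    exact propext ⟨fun k => k.trans this.symm, fun k => k.trans this⟩
  -- Linear interpolation of `ν` on each half of the edge, through its value at the midpoint.
  obtain ⟨f, hfv, hfe⟩ := M.toPreModel.exists_glue ν
    (fun e t => ν (M.src e) + (ν (M.param e (M.len e / 2)) - ν (M.src e)) *
      (min t (M.len e / 2) / (M.len e / 2)) +
      (ν (M.tgt e) - ν (M.param e (M.len e / 2))) * (max (t - M.len e / 2) 0 / (M.len e / 2)))
    (by
      intro e
      have := M.len_pos e
      rw [min_eq_left (by linarith), max_eq_right (by linarith)]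
      simp [Model.src])
    (by
      intro e
      have := M.len_pos e
      rw [min_eq_right (by linarith), max_eq_left (by linarith), sub_half, div_self (by linarith)]
      simp [Model.tgt])
  have hfh : ∀ h, ∀ t ∈ Icc 0 (M.halfLen h), f (M.half h t) = ν (M.half h 0) +
      (ν (M.half h (M.halfLen h)) - ν (M.half h 0)) * (t / M.halfLen h) := by
    rintro ⟨e, b⟩ t ht
    have := M.len_pos e
    have h1 := ht.1
    have h2 := ht.2
    rw [half, hfe e _ (half_mem_Icc ht)]
    unfold halfLen at h2 ⊢
    cases b
    · simp only [half, Model.src, Bool.false_eq_true, if_false]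
      rw [min_eq_left h2, max_eq_right (by linarith)]
      simp
    · simp only [half, Model.tgt, if_true]
      simp only at h2
      rw [min_eq_right (by linarith), max_eq_left (by linarith), div_self (by linarith), sub_zero,
        sub_half]
      have : (M.len e - t - M.len e / 2) / (M.len e / 2) = 1 - t / (M.len e / 2) := by
        field_simp; ring
      rw [this]
      ring
  have hf0 : ∀ t ∈ Icc 0 (M.halfLen h₀), f (M.half h₀ t) = t := by
    intro t ht
    rw [hfh h₀ t ht, hν0, hνr]
    field_simp
    ring
  have hf1 : ∀ t ∈ Icc 0 (M.halfLen h₀), f (i (M.half h₀ t)) = t := by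
    intro t ht
    rw [(hσ h₀).2 t ht, hfh _ t ((hσ h₀).1.symm ▸ ht), ← (hσ h₀).2 0 ⟨le_rfl, hr.le⟩, (hσ h₀).1,
      ← (hσ h₀).2 _ ⟨hr.le, le_rfl⟩, hνi, hνi, hν0, hνr]
    field_simp
    ring
  have hcases : ∀ z, f z = 0 ∨ f z = M.halfLen h₀ ∨ ∃ t ∈ Icc 0 (M.halfLen h₀), f z = t ∧
      (z = M.half h₀ t ∨ z = i (M.half h₀ t)) := by
    intro z
    rcases M.exists_half_eq z with hz | ⟨h, t, ht, rfl⟩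
    · rw [hfv z hz]
      rcases hν z with h | h
      · exact Or.inl h
      · exact Or.inr (Or.inl h)
    by_cases h1 : h = h₀
    · subst h1
      exact Or.inr (Or.inr ⟨t, Ioc_subset_Icc_self ht, hf0 t (Ioc_subset_Icc_self ht), Or.inl rfl⟩)
    by_cases h2 : h = σ h₀
    · subst h2
      rw [(hσ h₀).1] at ht
      have ht' := Ioc_subset_Icc_self ht
      rw [← (hσ h₀).2 t ht']
      exact Or.inr (Or.inr ⟨t, ht', hf1 t ht', Or.inr rfl⟩)
    · rw [hfh h t (Ioc_subset_Icc_self ht), hνh h h1 h2, sub_self, zero_mul, add_zero]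
      rcases hν (M.half h 0) with h | h
      · exact Or.inl h
      · exact Or.inr (Or.inl h)
  refine ⟨f, M.continuous_of_edges fun e => ?_, fun z => ?_, hf0, hf1, fun z hz => ?_⟩
  · refine ContinuousOn.congr (Continuous.continuousOn ?_) (hfe e)
    fun_prop
  · rcases hcases z with h | h | ⟨t, ht, h, -⟩
    · exact h.ge
    · rw [h]; exact hr.le
    · rw [h]; exact ht.1
  · rcases hcases z with h | h | ⟨t, ht, h, h'⟩
    · exact absurd h hz.1.ne'
    · exact absurd h hz.2.ne
    · rwa [← h] at h'

theorem IsCutFunction.zero {h₀ : M.Edge × Bool} {f : Γ → ℝ} (hf : M.IsCutFunction i h₀ f) :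
    f (M.half h₀ 0) = 0 ∧ f (i (M.half h₀ 0)) = 0 :=
  ⟨hf.half_eq 0 ⟨le_rfl, (M.halfLen_pos _).le⟩, hf.map_half_eq 0 ⟨le_rfl, (M.halfLen_pos _).le⟩⟩

/-- No half-edge is fixed by an involution with a cut function. -/
theorem IsCutFunction.map_half_ne {h₀ : M.Edge × Bool} {f : Γ → ℝ}
    (hf : M.IsCutFunction i h₀ f) (hB : Bridgeless M.verts) {t : ℝ}
    (ht : t ∈ Ioo 0 (M.halfLen h₀)) : i (M.half h₀ t) ≠ M.half h₀ t := by
  intro heq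
  have htI := Ioo_subset_Icc_self ht
  have hr := M.halfLen_pos h₀
  have h1 := hf.half_eq t htI
  have h2 := hf.half_eq _ ⟨hr.le, le_rfl⟩
  -- If the two rising half-edges met in this point, it would be the whole level `t`, although it
  -- does not disconnect `Γ`.
  obtain ⟨z, hz, hz'⟩ := (hB _ (half_notMem (Ioo_subset_Ioc_self ht))).intermediate_value
    (a := M.half h₀ 0) (b := M.half h₀ (M.halfLen h₀))
    (by intro h; have := hf.zero.1; rw [h, h1] at this; exact ht.1.ne' this)
    (by intro h; rw [h, h1] at h2; exact ht.2.ne h2) hf.continuous.continuousOn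
    (show t ∈ Icc _ _ by rw [hf.zero.1, h2]; exact htI)
  rcases hf.eq_half z (hz' ▸ ht) with h | h
  · rw [hz'] at h; exact hz h
  · rw [hz', heq] at h; exact hz h

/-- Where `f` is positive but less than `halfLen h₀`, the point lies on `h₀` or on its image, so the
zero set can only be approached through their starting points. -/
theorem IsCutFunction.eq_of_mem_closure {h₀ : M.Edge × Bool} {f : Γ → ℝ}
    (hf : M.IsCutFunction i h₀ f) {z : Γ} (hz : z ∈ closure {w | 0 < f w}) (hz0 : f z = 0) :
    z = M.half h₀ 0 ∨ z = i (M.half h₀ 0) := by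
  have hr := M.halfLen_pos h₀
  have hK : IsClosed (M.half h₀ '' Icc 0 (M.halfLen h₀) ∪
      i '' (M.half h₀ '' Icc 0 (M.halfLen h₀)) ∪ {w | M.halfLen h₀ ≤ f w}) := by
    have h1 : IsCompact (M.half h₀ '' Icc 0 (M.halfLen h₀)) :=
      isCompact_Icc.image_of_continuousOn (continuousOn_half h₀)
    exact (h1.isClosed.union (h1.image i.continuous).isClosed).union
      (isClosed_le continuous_const hf.continuous)
  have hsub : {w | 0 < f w} ⊆ M.half h₀ '' Icc 0 (M.halfLen h₀) ∪
      i '' (M.half h₀ '' Icc 0 (M.halfLen h₀)) ∪ {w | M.halfLen h₀ ≤ f w} := by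
    intro w hw
    rcases lt_or_ge (f w) (M.halfLen h₀) with h | h
    · left
      have hm : f w ∈ Icc 0 (M.halfLen h₀) := ⟨le_of_lt hw, h.le⟩
      rcases hf.eq_half w ⟨hw, h⟩ with h' | h'
      · exact Or.inl ⟨f w, hm, h'.symm⟩
      · exact Or.inr ⟨_, ⟨f w, hm, rfl⟩, h'.symm⟩
    · exact Or.inr h
  rcases closure_minimal hsub hK hz with (⟨t, ht, rfl⟩ | ⟨_, ⟨t, ht, rfl⟩, rfl⟩) | h
  · rw [hf.half_eq t ht] at hz0; rw [hz0]; exact Or.inl rfl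
  · rw [hf.map_half_eq t ht] at hz0; rw [hz0]; exact Or.inr rfl
  · have : M.halfLen h₀ ≤ f z := h
    linarith

/-- The condition `hj` puts both possible boundary points of `{g > 0}` into the zero set of `f`. -/
theorem IsCutFunction.pos_of_pos {h₀ : M.Edge × Bool} {f g : Γ → ℝ}
    (hf : M.IsCutFunction i h₀ f) (hg : M.IsCutFunction j h₀ g) (hB : Bridgeless M.verts)
    (hiv : ∀ t ∈ Ioo 0 (M.halfLen h₀), i (M.half h₀ t) ∉ M.verts)
    (hj : f (j (M.half h₀ 0)) = 0) {z : Γ} (hz : 0 < f z) : 0 < g z := by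
  by_contra hgz
  replace hgz : g z = 0 := le_antisymm (not_lt.1 hgz) (hg.nonneg z)
  have hr := M.halfLen_pos h₀
  set t := min (f z) (M.halfLen h₀) / 2 with ht
  have hm : 0 < min (f z) (M.halfLen h₀) := lt_min hz hr
  have ht0 : t ∈ Ioo 0 (M.halfLen h₀) :=
    ⟨half_pos hm, by linarith [min_le_right (f z) (M.halfLen h₀)]⟩
  have htz : t < f z := by linarith [min_le_left (f z) (M.halfLen h₀)]
  have htI := Ioo_subset_Icc_self ht0
  have h1 := hf.map_half_eq t htI
  -- The level `t` of `f` consists of a point of `h₀`, where `g > 0`, and of `i (M.half h₀ t)`.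
  -- Without the latter, the part of `{f > t}` outside the closure of `{g > 0}` would be separated
  -- from the start of `h₀`.
  have hsub := IsPreconnected.subset_left_of_subset_union
    (s := {i (M.half h₀ t)}ᶜ) (u := {w | t < f w} ∩ (closure {w | 0 < g w})ᶜ)
    (v := {w | f w < t} ∪ {w | 0 < g w})
    ((isOpen_lt continuous_const hf.continuous).inter isClosed_closure.isOpen_compl)
    ((isOpen_lt hf.continuous continuous_const).union (isOpen_lt continuous_const hg.continuous))
    (by
      rw [disjoint_left]
      rintro w ⟨h2, h3⟩ (h4 | h4)
      · exact absurd (show f w < t from h4) (lt_asymm (show t < f w from h2))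
      · exact h3 (subset_closure h4))
    (by
      intro w hw
      rcases lt_trichotomy (f w) t with h | h | h
      · exact Or.inr (Or.inl h)
      · rcases hf.eq_half w (h ▸ ht0) with h' | h'
        · right; right
          show 0 < g w
          rw [h', h, hg.half_eq t htI]; exact ht0.1
        · rw [h] at h'; exact absurd h' hw
      · by_cases hgw : 0 < g w
        · exact Or.inr (Or.inr hgw)
        · refine Or.inl ⟨h, fun hcl => ?_⟩
          have : f w = 0 := by
            rcases hg.eq_of_mem_closure hcl (le_antisymm (not_lt.1 hgw) (hg.nonneg w)) with k | k
            · rw [k]; exact hf.zero.1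
            · rw [k]; exact hj
          linarith [ht0.1])
    ⟨z, by intro h; rw [h, h1] at htz; exact lt_irrefl _ htz, htz, fun hcl => by
      have : f z = 0 := by
        rcases hg.eq_of_mem_closure hcl hgz with k | k
        · rw [k]; exact hf.zero.1
        · rw [k]; exact hj
      linarith⟩
    (hB _ (hiv t ht0))
  have h2 := hsub (show M.half h₀ 0 ∈ _ from by
    intro h; have := hf.zero.1; rw [h, h1] at this; exact ht0.1.ne' this)
  have h3 : t < f (M.half h₀ 0) := h2.1
  rw [hf.zero.1] at h3
  exact lt_asymm h3 ht0.1

/-- Different branches at one vertex are disjoint: their intersection is open and closed and misses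
the vertex. -/
theorem IsCutFunction.disjoint {h₁ h₂ : M.Edge × Bool} {f g : Γ → ℝ}
    (hσ : M.PermutesHalves i σ) (hi : IsInvolution i)
    (hf : M.IsCutFunction i h₁ f) (hg : M.IsCutFunction i h₂ g) (hv : M.half h₁ 0 = M.half h₂ 0)
    (h12 : h₁ ≠ h₂) (h12' : σ h₁ ≠ h₂) (z : Γ) : ¬ (0 < f z ∧ 0 < g z) := by
  have hconn := M.connectedSpace
  have h21 : σ h₂ ≠ h₁ := fun h => h12' (by rw [← h, hσ.involutive hi])
  have hs : σ h₁ ≠ σ h₂ := fun h => h12 (by rw [← hσ.involutive hi h₁, h, hσ.involutive hi])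
  intro hz
  have hempty : ∀ w, ¬ (f w ∈ Ioo 0 (M.halfLen h₁) ∧ g w ∈ Ioo 0 (M.halfLen h₂)) := by
    rintro w ⟨hfw, hgw⟩
    have e1 := (hσ h₁).2 _ (Ioo_subset_Icc_self hfw)
    have e2 := (hσ h₂).2 _ (Ioo_subset_Icc_self hgw)
    have hgw' := Ioo_subset_Ioc_self hgw
    rcases hf.eq_half w hfw with k1 | k1 <;> rcases hg.eq_half w hgw with k2 | k2
    · exact h12 (half_inj hfw hgw' (k1.symm.trans k2)).1
    · rw [e2] at k2
      exact h21 (half_inj hfw ((hσ h₂).1.symm ▸ hgw') (k1.symm.trans k2)).1.symm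
    · rw [e1] at k1
      exact h12' (half_inj ((hσ h₁).1.symm ▸ hfw) hgw' (k1.symm.trans k2)).1
    · rw [e1] at k1
      rw [e2] at k2
      exact hs (half_inj ((hσ h₁).1.symm ▸ hfw) ((hσ h₂).1.symm ▸ hgw') (k1.symm.trans k2)).1
  have hopen : IsOpen ({w | 0 < f w} ∩ {w | 0 < g w}) :=
    (isOpen_lt continuous_const hf.continuous).inter (isOpen_lt continuous_const hg.continuous)
  -- A limit point outside the intersection is the common start or its image, so both functions
  -- vanish there. Nearby points of the intersection would lie on the rising parts of both, against
  -- `hempty`.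
  have hclosed : IsClosed ({w | 0 < f w} ∩ {w | 0 < g w}) := by
    refine isClosed_of_closure_subset fun w hw => ?_
    have hwf : w ∈ closure {w | 0 < f w} := closure_mono inter_subset_left hw
    have hwg : w ∈ closure {w | 0 < g w} := closure_mono inter_subset_right hw
    by_contra hne
    have h0 : f w = 0 ∧ g w = 0 := by
      rcases (hf.nonneg w).eq_or_lt with h | h
      · refine ⟨h.symm, ?_⟩
        rcases hf.eq_of_mem_closure hwf h.symm with k | k
        · rw [k, hv]; exact hg.zero.1
        · rw [k, hv]; exact hg.zero.2
      · have hg0 : g w = 0 := le_antisymm (not_lt.1 fun h' => hne ⟨h, h'⟩) (hg.nonneg w)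
        refine ⟨?_, hg0⟩
        rcases hg.eq_of_mem_closure hwg hg0 with k | k
        · rw [k, ← hv]; exact hf.zero.1
        · rw [k, ← hv]; exact hf.zero.2
    have hnhds : {u | f u < M.halfLen h₁} ∩ {u | g u < M.halfLen h₂} ∈ 𝓝 w :=
      ((isOpen_lt hf.continuous continuous_const).inter
        (isOpen_lt hg.continuous continuous_const)).mem_nhds
        ⟨by rw [mem_ofPred_eq, h0.1]; exact M.halfLen_pos _,
          by rw [mem_ofPred_eq, h0.2]; exact M.halfLen_pos _⟩
    obtain ⟨u, hu1, hu2⟩ := mem_closure_iff_nhds.1 hw _ hnhds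
    exact hempty u ⟨⟨hu2.1, hu1.1⟩, ⟨hu2.2, hu1.2⟩⟩
  have huniv := IsClopen.eq_univ ⟨hclosed, hopen⟩ ⟨z, hz⟩
  have : M.half h₁ 0 ∈ {w | 0 < f w} ∩ {w | 0 < g w} := huniv ▸ mem_univ _
  have h1 : 0 < f (M.half h₁ 0) := this.1
  rw [hf.zero.1] at h1
  exact lt_irrefl _ h1

end Model

end MetricGraph

/-! ### Uniqueness of the involution. -/

namespace MetricGraph

open Set Filter Topology

variable {Γ : Type*} [MetricSpace Γ]

namespace Model

variable {M : Model Γ} {i j : Γ ≃ᵢ Γ} {σ τ : M.Edge × Bool → M.Edge × Bool}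

theorem dist_half_zero_le (h : M.Edge × Bool) {t : ℝ} (ht : t ∈ Icc 0 (M.halfLen h)) :
    dist (M.half h 0) (M.half h t) ≤ t := by
  refine (M.dist_param_le h.1 (half_mem_Icc ⟨le_rfl, (M.halfLen_pos h).le⟩)
    (half_mem_Icc ht)).trans (le_of_eq ?_)
  split_ifs
  · rw [sub_zero, sub_sub_cancel, abs_of_nonneg ht.1]
  · rw [zero_sub, abs_neg, abs_of_nonneg ht.1]

theorem exists_half_dist_lt (h : M.Edge × Bool) {ε : ℝ} (hε : 0 < ε) :
    ∃ t ∈ Ioo 0 (M.halfLen h), dist (M.half h 0) (M.half h t) < ε := by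
  have hr := M.halfLen_pos h
  have hm : 0 < min ε (M.halfLen h) := lt_min hε hr
  have h1 := min_le_left ε (M.halfLen h)
  have h2 := min_le_right ε (M.halfLen h)
  exact ⟨min ε (M.halfLen h) / 2, ⟨by linarith, by linarith⟩,
    (dist_half_zero_le h ⟨by linarith, by linarith⟩).trans_lt (by linarith)⟩

theorem IsCutFunction.map_mem_closure {h₀ : M.Edge × Bool} {f : Γ → ℝ}
    (hf : M.IsCutFunction i h₀ f) : i (M.half h₀ 0) ∈ closure {w | 0 < f w} := by
  rw [Metric.mem_closure_iff]
  intro ε hε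
  obtain ⟨t, ht, htε⟩ := exists_half_dist_lt h₀ hε
  refine ⟨i (M.half h₀ t), ?_, by rwa [i.dist_eq]⟩
  rw [mem_ofPred_eq, hf.map_half_eq t (Ioo_subset_Icc_self ht)]
  exact ht.1

theorem PermutesHalves.map_half_notMem (hσ : M.PermutesHalves i σ) (h : M.Edge × Bool) :
    ∀ t ∈ Ioo 0 (M.halfLen h), i (M.half h t) ∉ M.verts := by
  intro t ht
  rw [(hσ h).2 t (Ioo_subset_Icc_self ht)]
  exact half_notMem (by rw [(hσ h).1]; exact Ioo_subset_Ioc_self ht)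

/-- Then `{f > 0} = {g > 0}`. With `v` the start of `h₀`, its closure contains `i v` and `j v` as
zeros of both functions, and each of these is `v` or the other. -/
theorem IsCutFunction.map_eq_map {h₀ : M.Edge × Bool} {f g : Γ → ℝ}
    (hσ : M.PermutesHalves i σ) (hτ : M.PermutesHalves j τ) (hB : Bridgeless M.verts)
    (hf : M.IsCutFunction i h₀ f) (hg : M.IsCutFunction j h₀ g)
    (hfj : f (j (M.half h₀ 0)) = 0) (hgi : g (i (M.half h₀ 0)) = 0) :
    i (M.half h₀ 0) = j (M.half h₀ 0) := by
  have hfg : {w | 0 < f w} = {w | 0 < g w} := Subset.antisymm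
    (fun w hw => hf.pos_of_pos hg hB (hσ.map_half_notMem h₀) hfj hw)
    (fun w hw => hg.pos_of_pos hf hB (hτ.map_half_notMem h₀) hgi hw)
  rcases hg.eq_of_mem_closure (hfg ▸ hf.map_mem_closure) hgi with h1 | h1
  · rcases hf.eq_of_mem_closure (hfg ▸ hg.map_mem_closure) hfj with h2 | h2
    · rw [h1, h2]
    · exact h2.symm
  · exact h1

/-- Involutions with a tree as quotient agree on the vertices. -/
theorem map_vert_eq (hcan : M.IsCanonical) (hM : M.IsEdgeConnected 2) [Nonempty M.Edge]
    (hσ : M.PermutesHalves i σ) (hτ : M.PermutesHalves j τ) (hi : IsInvolution i)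
    (hj : IsInvolution j) {f g : M.Edge × Bool → Γ → ℝ} (hf : ∀ h, M.IsCutFunction i h (f h))
    (hg : ∀ h, M.IsCutFunction j h (g h)) {v : Γ} (hv : v ∈ M.verts) : i v = j v := by
  have hB := M.bridgeless_of_isEdgeConnected hM
  by_contra hne
  have key : ∀ h, M.half h 0 = v → 0 < f h (j v) ∨ 0 < g h (i v) := by
    rintro h rfl
    by_contra hcon
    rw [not_or, not_lt, not_lt] at hcon
    exact hne ((hf h).map_eq_map hσ hτ hB (hg h)
      (le_antisymm hcon.1 ((hf h).nonneg _)) (le_antisymm hcon.2 ((hg h).nonneg _)))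
  obtain ⟨h₁, h₂, h₃, e₁, e₂, e₃, h12, h13, h23⟩ := M.exists_three_halves hcan hM hv
  have hdf : ∀ {h h'}, M.half h 0 = v → M.half h' 0 = v → h ≠ h' → σ h ≠ h' →
      0 < f h (j v) → 0 < f h' (j v) → False := fun e e' k k' p p' =>
    (hf _).disjoint hσ hi (hf _) (e.trans e'.symm) k k' _ ⟨p, p'⟩
  have hdg : ∀ {h h'}, M.half h 0 = v → M.half h' 0 = v → h ≠ h' → τ h ≠ h' →
      0 < g h (i v) → 0 < g h' (i v) → False := fun e e' k k' p p' =>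
    (hg _).disjoint hτ hj (hg _) (e.trans e'.symm) k k' _ ⟨p, p'⟩
  -- If `i` fixes `v`, then `j v` lies in the branches of all three half-edges, two of which are not
  -- exchanged by `σ` and so have disjoint branches.
  by_cases hiv : i v = v
  · have hpos : ∀ h, M.half h 0 = v → 0 < f h (j v) := by
      intro h e
      refine (key h e).resolve_right ?_
      rw [hiv, ← e, (hg h).zero.1]
      exact lt_irrefl _
    by_cases hs : σ h₁ = h₂
    · exact hdf e₁ e₃ h13 (hs ▸ h23) (hpos _ e₁) (hpos _ e₃)
    · exact hdf e₁ e₂ h12 hs (hpos _ e₁) (hpos _ e₂)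
  by_cases hjv : j v = v
  · have hpos : ∀ h, M.half h 0 = v → 0 < g h (i v) := by
      intro h e
      refine (key h e).resolve_left ?_
      rw [hjv, ← e, (hf h).zero.1]
      exact lt_irrefl _
    by_cases hs : τ h₁ = h₂
    · exact hdg e₁ e₃ h13 (hs ▸ h23) (hpos _ e₁) (hpos _ e₃)
    · exact hdg e₁ e₂ h12 hs (hpos _ e₁) (hpos _ e₂)
  -- If both involutions move `v`, no two half-edges at `v` are exchanged. Two of the three fall
  -- under the same alternative of `key`, and their branches are disjoint.
  have hσv : ∀ {h h'}, M.half h 0 = v → M.half h' 0 = v → σ h ≠ h' := by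
    rintro h _ e e' rfl
    rw [← (hσ h).2 0 ⟨le_rfl, (M.halfLen_pos h).le⟩, e] at e'
    exact hiv e'
  have hτv : ∀ {h h'}, M.half h 0 = v → M.half h' 0 = v → τ h ≠ h' := by
    rintro h _ e e' rfl
    rw [← (hτ h).2 0 ⟨le_rfl, (M.halfLen_pos h).le⟩, e] at e'
    exact hjv e'
  rcases key h₁ e₁ with k1 | k1 <;> rcases key h₂ e₂ with k2 | k2 <;>
    rcases key h₃ e₃ with k3 | k3
  all_goals first
    | exact hdf e₁ e₂ h12 (hσv e₁ e₂) k1 k2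
    | exact hdf e₁ e₃ h13 (hσv e₁ e₃) k1 k3
    | exact hdf e₂ e₃ h23 (hσv e₂ e₃) k2 k3
    | exact hdg e₁ e₂ h12 (hτv e₁ e₂) k1 k2
    | exact hdg e₁ e₃ h13 (hτv e₁ e₃) k1 k3
    | exact hdg e₂ e₃ h23 (hτv e₂ e₃) k2 k3

/-- On a canonical model of a 2-edge-connected metric graph with at least one edge there is at
most one involution with a tree as quotient. -/
theorem involution_unique (hcan : M.IsCanonical) (hM : M.IsEdgeConnected 2) [Nonempty M.Edge]
    (hi : IsInvolution i) (hj : IsInvolution j) (hTi : IsTree (OrbitSpace i))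
    (hTj : IsTree (OrbitSpace j)) : i = j := by
  have hB := M.bridgeless_of_isEdgeConnected hM
  obtain ⟨σ, hσ⟩ := M.exists_permutesHalves hcan hM hi
  obtain ⟨τ, hτ⟩ := M.exists_permutesHalves hcan hM hj
  choose f hf using fun h => exists_isCutFunction hσ hi hTi h
  choose g hg using fun h => exists_isCutFunction hτ hj hTj h
  have hvert : ∀ v ∈ M.verts, i v = j v := fun v hv => map_vert_eq hcan hM hσ hτ hi hj hf hg hv
  -- As `i` and `j` agree at the start, a point of `i h` near its start has `0 < g h < halfLen`, so
  -- it lies on `h` or `j h`; it is not on `h`, since `i` does not fix interior points of `h`.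
  have hhalf : ∀ h, σ h = τ h := by
    intro h
    have hv := hvert _ (half_zero_mem h)
    have hfj : f h (j (M.half h 0)) = 0 := by rw [← hv]; exact (hf h).zero.2
    have hgi : g h (i (M.half h 0)) = 0 := by rw [hv]; exact (hg h).zero.2
    obtain ⟨ε, hε, hball⟩ := Metric.isOpen_iff.1
      (isOpen_lt (hg h).continuous (continuous_const (y := M.halfLen h))) (i (M.half h 0))
      (by rw [mem_ofPred_eq, hgi]; exact M.halfLen_pos h)
    obtain ⟨t, ht, htε⟩ := exists_half_dist_lt h hε
    have hlt : g h (i (M.half h t)) < M.halfLen h :=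
      hball (by rw [Metric.mem_ball, i.dist_eq, dist_comm]; exact htε)
    have htI := Ioo_subset_Icc_self ht
    have hpos : 0 < g h (i (M.half h t)) := by
      refine (hf h).pos_of_pos (hg h) hB (hσ.map_half_notMem h) hfj ?_
      rw [(hf h).map_half_eq t htI]
      exact ht.1
    have hmem : g h (i (M.half h t)) ∈ Ioo 0 (M.halfLen h) := ⟨hpos, hlt⟩
    have hσt := (hσ h).2 t htI
    have ht' : t ∈ Ioo 0 (M.halfLen (σ h)) := by rwa [(hσ h).1]
    rcases (hg h).eq_half _ hmem with k | k
    · rw [hσt] at k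
      obtain ⟨k1, -⟩ := half_inj ht' (by rw [← hσt]; exact Ioo_subset_Ioc_self hmem) k
      rw [k1] at hσt
      exact absurd hσt ((hf h).map_half_ne hB ht)
    · rw [(hτ h).2 _ (Ioo_subset_Icc_self hmem), hσt] at k
      exact (half_inj ht' (by rw [← hσt, (hτ h).1]; exact Ioo_subset_Ioc_self hmem) k).1
  ext x
  rcases M.exists_half_eq x with hx | ⟨h, t, ht, rfl⟩
  · exact hvert x hx
  · rw [(hσ h).2 t (Ioc_subset_Icc_self ht), (hτ h).2 t (Ioc_subset_Icc_self ht), hhalf]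

theorem subsingleton_of_isEmpty (hM : M.IsEdgeConnected 2) [IsEmpty M.Edge] :
    Subsingleton Γ := by
  have hv : ∀ x, x ∈ M.verts := fun x => (M.cover x).resolve_right fun ⟨e, _⟩ => isEmptyElim e
  refine ⟨fun x y => ?_⟩
  rcases (hM ∅ (by simp) x (hv x) y (hv y)).cases_head with h | ⟨_, ⟨e, _⟩, _⟩
  · exact h
  · exact isEmptyElim e

end Model

end MetricGraph

theorem corollaryc {Γ : Type*} [MetricSpace Γ]
    (hΓ : MetricGraph.IsMetricGraph Γ)
    (hcircle : ¬ Nonempty (Γ ≃ₜ Circle))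
    (hconn : MetricGraph.IsEdgeConnected Γ 2)
    (hhyp : MetricGraph.IsHyperelliptic Γ) :
    ∃! i : Γ ≃ᵢ Γ, MetricGraph.IsInvolution i ∧
      MetricGraph.IsTree (MetricGraph.OrbitSpace i) := by
  obtain ⟨M, hcan, hM⟩ := hconn
  have hB := M.bridgeless_of_isEdgeConnected hM
  obtain ⟨i, hi, hpair⟩ := MetricGraph.exists_involution hB hhyp
  have hT := MetricGraph.isTree_of_isPrincipal hB hi hpair
  refine ⟨i, ⟨hi, hT⟩, fun j ⟨hj, hTj⟩ => ?_⟩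
  -- Without edges `Γ` is a single point.
  rcases isEmpty_or_nonempty M.Edge with hE | hE
  · have := MetricGraph.Model.subsingleton_of_isEmpty hM
    ext x
    exact Subsingleton.elim _ _
  · exact MetricGraph.Model.involution_unique hcan hM hj hi hTj hT
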